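/- Let $d,d_1\ge 0$, $K\ge 2$, $n\ge 1$ be integers, let $\mathcal D$ be a probability distribution on $\mathbb R^d\times[K]$, let $\epsilon\ge 0$, $s_1,s_2>0$, $b_1,b_2\in\mathbb R$, $\gamma>0$, $\delta\in(0,1)$, and let $(\mathbf x_1,y_1),\dots,(\mathbf x_n,y_n)$ be drawn i.i.d. from $\mathcal D$. Put $\mathbf X=[\mathbf x_1,\dots,\mathbf x_n]\in\mathbb R^{d\times n}$ and $d_{\max}=\max\{d,d_1,K\}$. For $\mathbf W=(\mathbf W_1,\mathbf W_2)$ with $\mathbf W_1\in\mathbb R^{d_1\times d}$, $\mathbf W_2\in\mathbb R^{K\times d_1}$ let $f_{\mathbf W}(\mathbf x)=\mathbf W_2\,\rho(\mathbf W_1\mathbf x)$, where $\rho(t)=\max\{t,0\}$ acts coordinatewise, and let $\mathbf w_{2,k}\in\mathbb R^{d_1}$ be the $k$-th row of $\mathbf W_2$. For $\mathbf v\in\mathbb R^{d_1}$ and $\mathbf W\in\mathbb R^{d_1\times d}$ let $$Q(\mathbf v,\mathbf W)=\begin{bmatrix}0&\mathbf 1^\top\operatorname{diag}(\mathbf v)\mathbf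 W&0\\ \mathbf W^\top\operatorname{diag}(\mathbf v)\mathbf 1&0&\mathbf W^\top\operatorname{diag}(\mathbf v)\\ 0&\operatorname{diag}(\mathbf v)\mathbf W&0\end{bmatrix}\in\mathbb R^{(1+d+d_1)\times(1+d+d_1)},$$ and let $$\Theta(\mathbf W)=\max_{k\in[K],\,z=\pm1}\ \max_{\mathbf P\succeq0,\ \operatorname{diag}(\mathbf P)\le 1}\langle zQ(\mathbf w_{2,k},\mathbf W_1),\mathbf P\rangle .$$ Let $\mathcal F$ be the class of all $f_{\mathbf W}$ with spectral norms $\|\mathbf W_1\|_\sigma\le s_1$, $\|\mathbf W_2\|_\sigma\le s_2$, entrywise $\ell_1$ norm $\|\mathbf W_1\|_1\le b_1$, and $\|\mathbf W_2^\top\|_{2,1}=\sum_{k}\|\mathbf w_{2,k}\|_2\le b_2$. Then, with probability at least $1-\delta$ over the sample, for all $f_{\mathbf W}\in\mathcal F$ simultaneously, $$\begin{aligned}&\mathbb P_{(\mathbf x,y)\sim\mathcal D}\Big\{\exists\,\mathbf x'\in\mathbb R^d,\ \|\mathbf x'-\mathbf x\|_\infty\le\epsilon,\ \text{s.t. } y\ne\arg\max_{y'\in[K]}[f_{\mathbf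 W}(\mathbf x')]_{y'}\Big\}\\ &\le\frac1n\sum_{i=1}^n\mathbf 1\Big([f_{\mathbf W}(\mathbf x_i)]_{y_i}\le\gamma+\max_{y'\ne y_i}[f_{\mathbf W}(\mathbf x_i)]_{y'}+\frac\epsilon2\Theta(\mathbf W)\Big)\\ &\quad+\frac1\gamma\bigg(\frac4{n^{3/2}}+\frac{60\log(n)\log(2d_{\max})}{n}\,s_1s_2\Big(\big(\tfrac{b_1}{s_1}\big)^{2/3}+\big(\tfrac{b_2}{s_2}\big)^{2/3}\Big)^{3/2}\|\mathbf X\|_F+\frac{2\epsilon b_1b_2}{\sqrt n}\bigg)+3\sqrt{\frac{\log(2/\delta)}{2n}}.\end{aligned}$$ Here $y=\arg\max_{y'}z_{y'}$ means $z_y>\max_{y'\ne y}z_{y'}$, so ties count as misclassifications. -/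

import Mathlib

open MeasureTheory
open scoped Matrix

namespace AdvSDP

noncomputable section

/-- Spectral norm of a real matrix: the operator norm between Euclidean spaces. -/
def spectralNorm {m n : ℕ} (A : Matrix (Fin m) (Fin n) ℝ) : ℝ :=
  ‖(Matrix.toEuclideanLin (𝕜 := ℝ) A).toContinuousLinearMap‖

/-- Entrywise `ℓ₁` norm. -/
def entryNormOne {m n : ℕ} (A : Matrix (Fin m) (Fin n) ℝ) : ℝ :=
  ∑ i, ∑ j, |A i j|

/-- The `(2,1)` norm: the sum of the Euclidean norms of the columns. -/
def normTwoOne {m n : ℕ} (A : Matrix (Fin m) (Fin n) ℝ) : ℝ :=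
  ∑ j, √(∑ i, A i j ^ 2)

/-- Frobenius norm of the data matrix whose columns are `x 0, …, x (n - 1)`. -/
def frobData {d n : ℕ} (x : Fin n → Fin d → ℝ) : ℝ :=
  √(∑ i, ∑ j, x i j ^ 2)

/-- One-hidden-layer ReLU network `x ↦ W₂ ρ(W₁ x)`. -/
def net {d d₁ K : ℕ} (W₁ : Matrix (Fin d₁) (Fin d) ℝ) (W₂ : Matrix (Fin K) (Fin d₁) ℝ)
    (x : Fin d → ℝ) : Fin K → ℝ :=
  W₂ *ᵥ (fun j => max ((W₁ *ᵥ x) j) 0)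

/-- The norm constraints that define the hypothesis class. -/
def InClass {d d₁ K : ℕ} (s₁ s₂ b₁ b₂ : ℝ)
    (W₁ : Matrix (Fin d₁) (Fin d) ℝ) (W₂ : Matrix (Fin K) (Fin d₁) ℝ) : Prop :=
  spectralNorm W₁ ≤ s₁ ∧ spectralNorm W₂ ≤ s₂ ∧ entryNormOne W₁ ≤ b₁ ∧ normTwoOne W₂ᵀ ≤ b₂

/-- `max_{y' ≠ y} z_{y'}`; used only with at least two classes. -/
def maxOther {K : ℕ} (z : Fin K → ℝ) (y : Fin K) : ℝ :=
  ⨆ y' : {y' : Fin K // y' ≠ y}, z y'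

/-- The score vector `z` predicts the label `y` (`y = argmax z`): the margin
`z_y - max_{y' ≠ y} z_{y'}` is positive, so that ties count as errors. -/
def Predicts {K : ℕ} (z : Fin K → ℝ) (y : Fin K) : Prop :=
  0 < z y - maxOther z y

/-- The pairs `(x, y)` for which some perturbation of `x` in the closed `ℓ_∞` ball of radius `ε`
is misclassified (the distance on `Fin d → ℝ` is the sup distance). -/
def advError {d K : ℕ} (f : (Fin d → ℝ) → Fin K → ℝ) (ε : ℝ) : Set ((Fin d → ℝ) × Fin K) :=
  {p | ∃ x' ∈ Metric.closedBall p.1 ε, ¬ Predicts (f x') p.2}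

/-- The symmetric matrix `Q(v, W)` of the quadratic form
`(a, t, s) ↦ 2 (a 𝟏 + s)ᵀ diag(v) W t` on `ℝ × ℝ^d × ℝ^{d₁}`. -/
def Q {d d₁ : ℕ} (v : Fin d₁ → ℝ) (W : Matrix (Fin d₁) (Fin d) ℝ) :
    Matrix (Unit ⊕ (Fin d ⊕ Fin d₁)) (Unit ⊕ (Fin d ⊕ Fin d₁)) ℝ :=
  let B : Matrix (Fin d₁) (Fin d) ℝ := Matrix.diagonal v * W
  let r : Matrix Unit (Fin d) ℝ := Matrix.replicateRow Unit (1 ᵥ* B)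
  Matrix.fromBlocks
    0                          (Matrix.fromCols r 0)
    (Matrix.fromRows rᵀ 0)     (Matrix.fromBlocks 0 Bᵀ B 0)

/-- `max ⟨A, P⟩` over positive semidefinite `P` with diagonal entries at most `1`
(a maximum over a nonempty compact set), where `⟨A, P⟩ = ∑ᵢⱼ Aᵢⱼ Pᵢⱼ`. -/
def sdpMax {ι : Type} [Fintype ι] (A : Matrix ι ι ℝ) : ℝ :=
  sSup {r | ∃ P : Matrix ι ι ℝ, P.PosSemidef ∧ (∀ i, P i i ≤ 1) ∧ r = ∑ i, ∑ j, A i j * P i j}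

/-- `max_{k, z = ±1} max_P ⟨z Q(w_{2,k}, W₁), P⟩`, with `w_{2,k}` the `k`-th row of `W₂`. -/
def sdpTerm {d d₁ K : ℕ} (W₁ : Matrix (Fin d₁) (Fin d) ℝ) (W₂ : Matrix (Fin K) (Fin d₁) ℝ) : ℝ :=
  ⨆ k : Fin K, max (sdpMax (Q (W₂ k) W₁)) (sdpMax (-(Q (W₂ k) W₁)))

open Classical in
/-- Fraction of the sample on which the margin reduced by the SDP term is at most `γ`. -/
def surrogateError {d d₁ K n : ℕ} (ε γ : ℝ) (W₁ : Matrix (Fin d₁) (Fin d) ℝ)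
    (W₂ : Matrix (Fin K) (Fin d₁) ℝ) (S : Fin n → (Fin d → ℝ) × Fin K) : ℝ :=
  (1 / (n : ℝ)) * ∑ i, if net W₁ W₂ (S i).1 (S i).2 ≤
      γ + maxOther (net W₁ W₂ (S i).1) (S i).2 + ε / 2 * sdpTerm W₁ W₂ then (1 : ℝ) else 0

end

end AdvSDP

/-! The deterministic half of the argument rests on the secant slopes of ReLU. They lie in [0, 1],
so each can be written (1 + u) / 2 with |u| ≤ 1. Moving the input by ε t with |t_j| ≤ 1 therefore
changes the score of class k by ε / 4 times the quadratic form of Q(w_{2,k}, W₁) at p = (1, t, u).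
Since p pᵀ is feasible for the semidefinite program, each score moves by at most ε / 4 times
`sdpTerm`, and the margin drops by at most twice that (`abs_net_sub_net_le`, `advError_subset`). The
robust error is thus dominated by the mean ramp loss of the reduced margin, whose empirical mean is
at most `surrogateError`.

For uniform convergence, symmetrization and two uses of McDiarmid's inequality
(`one_sub_le_measureReal_finite`) leave the empirical Rademacher complexity of the ramp losses.
Contraction removes the ramp at the price 1 / γ, and subadditivity separates the margins from the
shift. The shift is a single number in [0, 2 ε b₁ b₂] per network (`sdpTerm_le`), so its complexity
is of order √n. The margins are treated by chaining (`radSup_margin_le`). Maurey sparsification of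
both layers with 4 ^ j atoms each gives a net at scale (s₂ b₁ + s₁ b₂) ‖X‖ / 2 ^ j with
log-cardinality at most 4 · 4 ^ j · log (2 d_max). The growth of the net cancels the shrinking of
the scale, so every level costs the same, and the number of levels gives the factor log n.

The bounds hold for finite families with constants independent of their size. A dense sequence and
continuity of the loss in its parameters extend them to the whole class. -/

namespace AdvSDP

/-! ### The semidefinite relaxation -/

/-- Testing positivity on e_i ± e_j gives 2 |P_ij| ≤ P_ii + P_jj ≤ 2. -/
lemma abs_apply_le_one_of_posSemidef {ι : Type*} [Fintype ι] {P : Matrix ι ι ℝ}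
    (hP : P.PosSemidef) (hd : ∀ i, P i i ≤ 1) (i j : ι) : |P i j| ≤ 1 := by
  classical
  have hsymm : P j i = P i j := by simpa using hP.1.apply i j
  have key : ∀ s : ℝ, 0 ≤ P i i + s * P i j + (s * P j i + s * s * P j j) := by
    intro s
    have h := hP.dotProduct_mulVec_nonneg (Pi.single i 1 + Pi.single j s)
    simp [Matrix.mulVec_add, add_dotProduct, dotProduct_add] at h
    linarith
  have h1 := key 1
  have h2 := key (-1)
  have hi := hd i
  have hj := hd j
  rw [abs_le]
  constructor <;> nlinarith

lemma sum_mul_le_sum_abs {ι : Type*} [Fintype ι] (A : Matrix ι ι ℝ) {P : Matrix ι ι ℝ}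
    (hP : P.PosSemidef) (hd : ∀ i, P i i ≤ 1) :
    ∑ i, ∑ j, A i j * P i j ≤ ∑ i, ∑ j, |A i j| := by
  refine Finset.sum_le_sum fun i _ => Finset.sum_le_sum fun j _ => ?_
  refine (le_abs_self _).trans ?_
  rw [abs_mul]
  exact mul_le_of_le_one_right (abs_nonneg _) (abs_apply_le_one_of_posSemidef hP hd i j)

lemma sdpMax_le_sum_abs {ι : Type} [Fintype ι] (A : Matrix ι ι ℝ) :
    sdpMax A ≤ ∑ i, ∑ j, |A i j| := by
  refine Real.sSup_le ?_ (by positivity)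
  rintro r ⟨P, hP, hd, rfl⟩
  exact sum_mul_le_sum_abs A hP hd

lemma sum_mul_le_sdpMax {ι : Type} [Fintype ι] (A : Matrix ι ι ℝ) {P : Matrix ι ι ℝ}
    (hP : P.PosSemidef) (hd : ∀ i, P i i ≤ 1) :
    ∑ i, ∑ j, A i j * P i j ≤ sdpMax A := by
  refine le_csSup ⟨∑ i, ∑ j, |A i j|, ?_⟩ ⟨P, hP, hd, rfl⟩
  rintro r ⟨P, hP, hd, rfl⟩
  exact sum_mul_le_sum_abs A hP hd

lemma sdpMax_nonneg {ι : Type} [Fintype ι] (A : Matrix ι ι ℝ) : 0 ≤ sdpMax A := by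
  simpa using sum_mul_le_sdpMax A (P := 0) Matrix.PosSemidef.zero (by simp)

lemma sdpTerm_nonneg {d d₁ K : ℕ} (W₁ : Matrix (Fin d₁) (Fin d) ℝ)
    (W₂ : Matrix (Fin K) (Fin d₁) ℝ) : 0 ≤ sdpTerm W₁ W₂ :=
  Real.iSup_nonneg fun _ => le_max_of_le_left (sdpMax_nonneg _)

/-- There are four nonzero blocks: two copies of diag(v) W, and two borders made of its column sums,
which the triangle inequality controls by the same quantity. -/
lemma sum_abs_Q_le {d d₁ : ℕ} (v : Fin d₁ → ℝ) (W : Matrix (Fin d₁) (Fin d) ℝ) :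
    ∑ i, ∑ j, |Q v W i j| ≤ 4 * ∑ i, ∑ j, |v i| * |W i j| := by
  have h1 : ∑ j, |(1 ᵥ* (Matrix.diagonal v * W)) j| ≤ ∑ i, ∑ j, |v i| * |W i j| := by
    rw [Finset.sum_comm]
    refine Finset.sum_le_sum fun j _ => ?_
    simp only [Matrix.vecMul, dotProduct, Matrix.diagonal_mul, Pi.one_apply, one_mul]
    refine (Finset.abs_sum_le_sum_abs _ _).trans (le_of_eq ?_)
    simp [abs_mul]
  have h2 : ∑ j, ∑ i, |v i| * |W i j| = ∑ i, ∑ j, |v i| * |W i j| := Finset.sum_comm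
  simp only [Q, Fintype.sum_sum_type, Matrix.fromBlocks_apply₁₁, Matrix.fromBlocks_apply₁₂,
    Matrix.fromBlocks_apply₂₁, Matrix.fromBlocks_apply₂₂, Matrix.fromCols_apply_inl,
    Matrix.fromCols_apply_inr, Matrix.fromRows_apply_inl, Matrix.fromRows_apply_inr,
    Matrix.zero_apply, abs_zero, Finset.sum_const_zero, Matrix.transpose_apply,
    Matrix.replicateRow_apply, Matrix.diagonal_mul, abs_mul, Finset.univ_unique,
    Finset.sum_singleton, Finset.sum_add_distrib, add_zero, zero_add]
  linarith

lemma abs_apply_le_normTwoOne_transpose {d₁ K : ℕ} (W₂ : Matrix (Fin K) (Fin d₁) ℝ)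
    (k : Fin K) (i : Fin d₁) : |W₂ k i| ≤ normTwoOne W₂ᵀ := by
  have h1 : |W₂ k i| ≤ √(∑ i, W₂ k i ^ 2) := by
    refine Real.abs_le_sqrt ?_
    exact Finset.single_le_sum (f := fun i => W₂ k i ^ 2) (fun _ _ => sq_nonneg _)
      (Finset.mem_univ i)
  refine h1.trans ?_
  exact Finset.single_le_sum (f := fun k => √(∑ i, W₂ k i ^ 2)) (fun _ _ => Real.sqrt_nonneg _)
      (Finset.mem_univ k)

/-- This crude bound serves only to limit the range of the margin shift in the complexity estimate.
-/
lemma sdpTerm_le {d d₁ K : ℕ} {s₁ s₂ b₁ b₂ : ℝ} {W₁ : Matrix (Fin d₁) (Fin d) ℝ}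
    {W₂ : Matrix (Fin K) (Fin d₁) ℝ} (h : InClass s₁ s₂ b₁ b₂ W₁ W₂) :
    sdpTerm W₁ W₂ ≤ 4 * b₁ * b₂ := by
  obtain ⟨-, -, h₁, h₂⟩ := h
  have hb₁ : 0 ≤ b₁ := le_trans (by unfold entryNormOne; positivity) h₁
  have hb₂ : 0 ≤ b₂ := le_trans (by unfold normTwoOne; positivity) h₂
  have hQ : ∀ k, ∑ i, ∑ j, |Q (W₂ k) W₁ i j| ≤ 4 * b₁ * b₂ := by
    intro k
    refine (sum_abs_Q_le _ _).trans ?_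
    have : ∑ i, ∑ j, |W₂ k i| * |W₁ i j| ≤ b₂ * b₁ := by
      calc ∑ i, ∑ j, |W₂ k i| * |W₁ i j| ≤ ∑ i, ∑ j, b₂ * |W₁ i j| := by
            gcongr with i _ j _
            exact (abs_apply_le_normTwoOne_transpose W₂ k i).trans h₂
        _ = b₂ * entryNormOne W₁ := by simp [entryNormOne, Finset.mul_sum]
        _ ≤ b₂ * b₁ := by gcongr
    linarith
  refine Real.iSup_le (fun k => max_le ?_ ?_) (by positivity)
  · exact (sdpMax_le_sum_abs _).trans (hQ k)
  · refine (sdpMax_le_sum_abs _).trans ?_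
    simpa using hQ k

lemma sum_Q_mul {d d₁ : ℕ} (v : Fin d₁ → ℝ) (W : Matrix (Fin d₁) (Fin d) ℝ)
    (t : Fin d → ℝ) (u : Fin d₁ → ℝ) :
    let p : Unit ⊕ (Fin d ⊕ Fin d₁) → ℝ := Sum.elim (fun _ => 1) (Sum.elim t u)
    ∑ i, ∑ j, Q v W i j * (p i * p j) = 2 * ∑ i, (1 + u i) * v i * (W *ᵥ t) i := by
  have h2 : ∑ j, (∑ i, v i * W i j) * t j = ∑ i, ∑ j, v i * W i j * t j := by
    simp only [Finset.sum_mul]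
    exact Finset.sum_comm
  have h3 : ∑ j, ∑ i, v i * W i j * (t j * u i) = ∑ i, ∑ j, v i * W i j * (u i * t j) := by
    rw [Finset.sum_comm]
    simp only [mul_comm]
  have h6 : ∑ i, (1 + u i) * v i * (W *ᵥ t) i = ∑ i, ∑ j, v i * W i j * t j +
      ∑ i, ∑ j, v i * W i j * (u i * t j) := by
    simp only [Matrix.mulVec, dotProduct, Finset.mul_sum, ← Finset.sum_add_distrib]
    refine Finset.sum_congr rfl fun i _ => Finset.sum_congr rfl fun j _ => by ring
  simp only [Q, Fintype.sum_sum_type, Matrix.fromBlocks_apply₁₁, Matrix.fromBlocks_apply₁₂,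
    Matrix.fromBlocks_apply₂₁, Matrix.fromBlocks_apply₂₂, Matrix.fromCols_apply_inl,
    Matrix.fromCols_apply_inr, Matrix.fromRows_apply_inl, Matrix.fromRows_apply_inr,
    Matrix.zero_apply, Finset.sum_const_zero, Matrix.transpose_apply, zero_mul,
    Matrix.replicateRow_apply, Matrix.diagonal_mul, Finset.univ_unique, Matrix.vecMul, dotProduct,
    Pi.one_apply, Sum.elim_inl, Sum.elim_inr, one_mul,
    Finset.sum_singleton, Finset.sum_add_distrib, add_zero, zero_add]
  rw [h3, h6]
  simp only [mul_one]
  rw [h2]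
  ring

/-- The rank-one matrix p pᵀ with p = (1, t, u) is feasible because the coordinates of p are bounded
by 1. Having both signs of Q in `sdpTerm` gives the absolute value. -/
lemma sum_mul_mulVec_le_sdpTerm {d d₁ K : ℕ} (W₁ : Matrix (Fin d₁) (Fin d) ℝ)
    (W₂ : Matrix (Fin K) (Fin d₁) ℝ) (k : Fin K) {t : Fin d → ℝ} {u : Fin d₁ → ℝ}
    (ht : ∀ j, |t j| ≤ 1) (hu : ∀ i, |u i| ≤ 1) :
    |2 * ∑ i, (1 + u i) * W₂ k i * (W₁ *ᵥ t) i| ≤ sdpTerm W₁ W₂ := by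
  set p : Unit ⊕ (Fin d ⊕ Fin d₁) → ℝ := Sum.elim (fun _ => 1) (Sum.elim t u) with hp
  have hP : (Matrix.vecMulVec p p).PosSemidef := by
    simpa using Matrix.posSemidef_vecMulVec_self_star p
  have hd : ∀ i, (Matrix.vecMulVec p p) i i ≤ 1 := by
    intro i
    have : |p i| ≤ 1 := by
      rcases i with _ | i | i
      · simp [hp]
      · simpa [hp] using ht i
      · simpa [hp] using hu i
    rw [Matrix.vecMulVec_apply, ← abs_mul_abs_self]
    exact mul_le_one₀ this (abs_nonneg _) this
  have h1 := sum_mul_le_sdpMax (Q (W₂ k) W₁) hP hd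
  have h2 := sum_mul_le_sdpMax (-Q (W₂ k) W₁) hP hd
  have h3 := sum_Q_mul (W₂ k) W₁ t u
  simp only [Matrix.neg_apply, neg_mul, Finset.sum_neg_distrib, Matrix.vecMulVec_apply] at h1 h2
  simp only [← hp] at h3
  rw [h3] at h1 h2
  have h4 : max (sdpMax (Q (W₂ k) W₁)) (sdpMax (-(Q (W₂ k) W₁))) ≤ sdpTerm W₁ W₂ :=
    le_ciSup (f := fun k => max (sdpMax (Q (W₂ k) W₁)) (sdpMax (-(Q (W₂ k) W₁))))
      (Set.finite_range _).bddAbove k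
  rw [abs_le]
  have := le_max_left (sdpMax (Q (W₂ k) W₁)) (sdpMax (-(Q (W₂ k) W₁)))
  have := le_max_right (sdpMax (Q (W₂ k) W₁)) (sdpMax (-(Q (W₂ k) W₁)))
  constructor <;> linarith

/-- The secant slope of ReLU lies in [0, 1]. Recentring it as (1 + u) / 2 makes u admissible for the
diagonal constraint of the semidefinite program. -/
lemma exists_relu_sub_relu_eq (a b : ℝ) :
    ∃ u : ℝ, |u| ≤ 1 ∧ max a 0 - max b 0 = (1 + u) / 2 * (a - b) := by
  rcases eq_or_ne a b with rfl | hab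
  · exact ⟨0, by simp⟩
  have hne : a - b ≠ 0 := sub_ne_zero.2 hab
  refine ⟨2 * ((max a 0 - max b 0) / (a - b)) - 1, ?_, by field_simp; ring⟩
  have h : 0 ≤ (max a 0 - max b 0) / (a - b) ∧ (max a 0 - max b 0) / (a - b) ≤ 1 := by
    rcases lt_or_gt_of_ne hab with h | h
    · rw [← neg_div_neg_eq]
      have h' : 0 < -(a - b) := by linarith
      rw [div_le_one h']
      refine ⟨div_nonneg ?_ h'.le, ?_⟩
      · have := max_le_max_right 0 h.le
        linarith
      · rcases max_cases a 0 with ha | ha <;> rcases max_cases b 0 with hb | hb <;> linarith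
    · have h' : 0 < a - b := by linarith
      rw [div_le_one h']
      refine ⟨div_nonneg ?_ h'.le, ?_⟩
      · have := max_le_max_right 0 h.le
        linarith
      · rcases max_cases a 0 with ha | ha <;> rcases max_cases b 0 with hb | hb <;> linarith
  rw [abs_le]
  constructor <;> linarith [h.1, h.2]

lemma abs_net_sub_net_le {d d₁ K : ℕ} (W₁ : Matrix (Fin d₁) (Fin d) ℝ)
    (W₂ : Matrix (Fin K) (Fin d₁) ℝ) {ε : ℝ} {x x' : Fin d → ℝ}
    (hx : x' ∈ Metric.closedBall x ε) (k : Fin K) :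
    |net W₁ W₂ x' k - net W₁ W₂ x k| ≤ ε / 4 * sdpTerm W₁ W₂ := by
  have hdist : dist x' x ≤ ε := hx
  have hε : 0 ≤ ε := dist_nonneg.trans hdist
  -- The displacement is rescaled by ε⁻¹ below, so ε = 0 is set aside.
  rcases hε.eq_or_lt with rfl | hε
  · have : x' = x := dist_le_zero.1 hdist
    simp [this]
  have hcoord : ∀ j, |x' j - x j| ≤ ε := fun j =>
    (Real.dist_eq _ _).symm.le.trans ((dist_le_pi_dist x' x j).trans hdist)
  choose u hu hu' using fun i => exists_relu_sub_relu_eq ((W₁ *ᵥ x') i) ((W₁ *ᵥ x) i)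
  have ht : ∀ j, |(ε⁻¹ • (x' - x)) j| ≤ 1 := by
    intro j
    simp only [Pi.smul_apply, Pi.sub_apply, smul_eq_mul, abs_mul, abs_inv, abs_of_pos hε]
    rw [inv_mul_le_iff₀ hε]
    simpa using hcoord j
  have h := sum_mul_mulVec_le_sdpTerm W₁ W₂ k ht hu
  -- In ε / 4, one factor 1 / 2 comes from the slope (1 + u) / 2 and the other offsets the factor 2
  -- that the symmetric matrix Q produces.
  have heq : net W₁ W₂ x' k - net W₁ W₂ x k =
      ε / 4 * (2 * ∑ i, (1 + u i) * W₂ k i * (W₁ *ᵥ (ε⁻¹ • (x' - x))) i) := by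
    simp only [net, Matrix.mulVec_smul, Matrix.mulVec_sub, Pi.smul_apply, Pi.sub_apply, smul_eq_mul]
    rw [Matrix.mulVec, Matrix.mulVec, dotProduct, dotProduct, ← Finset.sum_sub_distrib,
      Finset.mul_sum, Finset.mul_sum]
    refine Finset.sum_congr rfl fun i _ => ?_
    rw [← mul_sub, hu']
    field_simp
    ring
  rw [heq, abs_mul, abs_of_pos (by positivity : 0 < ε / 4)]
  gcongr

/-! ### The margin -/

/-- The margin `z_y - max_{y' ≠ y} z_{y'}`. -/
noncomputable def margin {K : ℕ} (z : Fin K → ℝ) (y : Fin K) : ℝ := z y - maxOther z y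

lemma maxOther_le_add {K : ℕ} (hK : 2 ≤ K) {z z' : Fin K → ℝ} {y : Fin K} {r : ℝ}
    (h : ∀ k, k ≠ y → z k ≤ z' k + r) : maxOther z y ≤ maxOther z' y + r := by
  have : Nontrivial (Fin K) := Fin.nontrivial_iff_two_le.2 hK
  obtain ⟨k₀, hk₀⟩ := exists_ne y
  have : Nonempty {k : Fin K // k ≠ y} := ⟨⟨k₀, hk₀⟩⟩
  refine ciSup_le fun k => (h k k.2).trans ?_
  gcongr
  exact le_ciSup (f := fun k : {k : Fin K // k ≠ y} => z' k) (Set.finite_range _).bddAbove k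

/-- The score of the true class falls, and the best rival score rises, by at most ε / 4 times
`sdpTerm` each. -/
lemma advError_subset {d d₁ K : ℕ} (hK : 2 ≤ K) (W₁ : Matrix (Fin d₁) (Fin d) ℝ)
    (W₂ : Matrix (Fin K) (Fin d₁) ℝ) (ε : ℝ) :
    advError (net W₁ W₂) ε ⊆
      {p | margin (net W₁ W₂ p.1) p.2 - ε / 2 * sdpTerm W₁ W₂ ≤ 0} := by
  rintro ⟨x, y⟩ ⟨x', hx', hp⟩
  simp only [Predicts, not_lt, Set.mem_ofPred_eq, margin] at hp ⊢
  have h := fun k => abs_le.1 (abs_net_sub_net_le W₁ W₂ hx' k)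
  have h1 : maxOther (net W₁ W₂ x') y ≤ maxOther (net W₁ W₂ x) y + ε / 4 * sdpTerm W₁ W₂ :=
    maxOther_le_add hK fun k _ => by linarith [(h k).2]
  linarith [(h y).1]

/-! ### The bounded differences inequality -/

section Concentration

variable {Z : Type*} [MeasurableSpace Z] (μ : Measure Z) [IsProbabilityMeasure μ]

lemma integrable_of_forall_abs_le {Ω : Type*} [MeasurableSpace Ω] {ν : Measure Ω}
    [IsFiniteMeasure ν] {f : Ω → ℝ} (hf : Measurable f) {C : ℝ} (hC : ∀ x, |f x| ≤ C) :
    Integrable f ν :=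
  Integrable.of_bound hf.aestronglyMeasurable C (.of_forall hC)

lemma integrable_exp_of_forall_abs_le {Ω : Type*} [MeasurableSpace Ω] {ν : Measure Ω}
    [IsFiniteMeasure ν] {f : Ω → ℝ} (hf : Measurable f) {C : ℝ} (hC : ∀ x, |f x| ≤ C) :
    Integrable (fun x => Real.exp (f x)) ν :=
  integrable_of_forall_abs_le (Real.measurable_exp.comp hf) (C := Real.exp C) fun x => by
    rw [Real.abs_exp]
    exact Real.exp_le_exp.2 ((le_abs_self _).trans (hC x))

/-- Hoeffding's lemma: bounded oscillation places f in an interval of length c starting at its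
infimum. -/
lemma integral_exp_sub_integral_le {f : Z → ℝ} (hf : Measurable f) {c : ℝ}
    (hc : ∀ x y, |f x - f y| ≤ c) (t : ℝ) :
    ∫ x, Real.exp (t * (f x - ∫ x, f x ∂μ)) ∂μ ≤ Real.exp (c ^ 2 * t ^ 2 / 8) := by
  have : Nonempty Z := μ.nonempty_of_neZero
  obtain ⟨x₀⟩ := id this
  have hbdd : BddBelow (Set.range f) := ⟨f x₀ - c, by
    rintro _ ⟨x, rfl⟩
    linarith [(abs_le.1 (hc x x₀)).1]⟩
  set a := ⨅ x, f x with ha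
  have hmem : ∀ x, f x ∈ Set.Icc a (a + c) := by
    intro x
    refine ⟨ciInf_le hbdd x, ?_⟩
    have : f x - c ≤ a := le_ciInf fun y => by linarith [(abs_le.1 (hc x y)).2]
    linarith
  have h := (ProbabilityTheory.hasSubgaussianMGF_of_mem_Icc (μ := μ) hf.aemeasurable
    (.of_forall hmem)).mgf_le t
  simp only [ProbabilityTheory.mgf] at h
  refine h.trans (Real.exp_le_exp.2 (le_of_eq ?_))
  simp only [add_sub_cancel_left, NNReal.coe_pow, NNReal.coe_div, coe_nnnorm, NNReal.coe_ofNat,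
    Real.norm_eq_abs, div_pow, sq_abs]
  ring

lemma integral_pi_succ {n : ℕ} (F : (Fin (n + 1) → Z) → ℝ) :
    ∫ S, F S ∂(Measure.pi fun _ : Fin (n + 1) => μ) =
      ∫ p : Z × (Fin n → Z), F (Fin.cons p.1 p.2) ∂(μ.prod (Measure.pi fun _ : Fin n => μ)) := by
  have h := (measurePreserving_piFinSuccAbove (fun _ : Fin (n + 1) => μ) 0).symm
  rw [← h.integral_comp' F]
  simp [MeasurableEquiv.piFinSuccAbove, Fin.insertNthEquiv]

lemma measurable_finCons {n : ℕ} :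
    Measurable fun p : Z × (Fin n → Z) => (Fin.cons p.1 p.2 : Fin (n + 1) → Z) := by
  refine measurable_pi_lambda _ fun i => ?_
  refine Fin.cases ?_ (fun j => ?_) i
  · simpa using measurable_fst
  · simpa [Function.comp_def] using (measurable_pi_apply j).comp measurable_snd

/-- This is the martingale argument, by induction on the number of coordinates. With g the average
of f over all coordinates but the first, f - m splits into (f - g) + (g - m). The first part falls
under the induction hypothesis for each fixed first coordinate, the second under Hoeffding's lemma,
as g inherits the oscillation bound c. -/
lemma integral_exp_le_of_bounded_differences {n : ℕ} {f : (Fin n → Z) → ℝ} (hf : Measurable f)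
    {C c : ℝ} (hC : ∀ S, |f S| ≤ C) (hc : ∀ S i z, |f (Function.update S i z) - f S| ≤ c)
    (t : ℝ) :
    ∫ S, Real.exp (t * (f S - ∫ S, f S ∂(Measure.pi fun _ => μ))) ∂(Measure.pi fun _ => μ) ≤
      Real.exp (n * (c ^ 2 * t ^ 2 / 8)) := by
  induction n with
  | zero =>
    have hconst : ∀ S, f S = f default := fun S => congrArg f (Subsingleton.elim _ _)
    simp only [hconst]
    simp
  | succ n ih =>
    set ν : Measure (Fin n → Z) := Measure.pi fun _ => μ with hν
    have hcons := measurable_finCons (Z := Z) (n := n)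
    have hfc : Measurable fun p : Z × (Fin n → Z) => f (Fin.cons p.1 p.2) := hf.comp hcons
    set g : Z → ℝ := fun z => ∫ S, f (Fin.cons z S) ∂ν with hg
    have hgm : Measurable g := hfc.stronglyMeasurable.integral_prod_right.measurable
    have hC0 : 0 ≤ C := by
      have : Nonempty (Fin (n + 1) → Z) :=
        (Measure.pi fun _ : Fin (n + 1) => μ).nonempty_of_neZero
      exact (abs_nonneg _).trans (hC this.some)
    have hfz : ∀ z, Measurable fun S => f (Fin.cons z S) := fun z =>
      hfc.comp measurable_prodMk_left
    have hint : ∀ z, Integrable (fun S => f (Fin.cons z S)) ν := fun z =>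
      integrable_of_forall_abs_le (hfz z) fun S => hC _
    have hgC : ∀ z, |g z| ≤ C := by
      intro z
      have := norm_integral_le_of_norm_le_const (μ := ν) (f := fun S => f (Fin.cons z S))
        (.of_forall fun S => hC _)
      simpa using this
    have hE : ∫ S, f S ∂(Measure.pi fun _ => μ) = ∫ z, g z ∂μ := by
      rw [integral_pi_succ, integral_prod]
      exact integrable_of_forall_abs_le hfc fun p => hC _
    have hgosc : ∀ x y, |g x - g y| ≤ c := by
      intro x y
      rw [hg]
      simp only
      rw [← integral_sub (hint x) (hint y)]
      have := norm_integral_le_of_norm_le_const (μ := ν)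
        (f := fun S => f (Fin.cons x S) - f (Fin.cons y S)) (C := c) (.of_forall fun S => by
          have := hc (Fin.cons y S) 0 x
          simpa [Fin.update_cons_zero] using this)
      simpa using this
    have hinner : ∀ z, ∫ S, Real.exp (t * (f (Fin.cons z S) - g z)) ∂ν ≤
        Real.exp (n * (c ^ 2 * t ^ 2 / 8)) := fun z =>
      ih (hfz z) (fun S => hC _) fun S i w => by
        rw [Fin.cons_update]
        exact hc _ _ _
    set m := ∫ z, g z ∂μ with hm
    have hmC : |m| ≤ C := by
      have := norm_integral_le_of_norm_le_const (μ := μ) (f := g) (.of_forall fun S => hgC _)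
      simpa using this
    have hbd : ∀ a b : ℝ, |a| ≤ C → |b| ≤ C → |t * (a - b)| ≤ |t| * (C + C) := by
      intro a b ha hb
      rw [abs_mul]
      gcongr
      exact (abs_sub _ _).trans (add_le_add ha hb)
    rw [hE, integral_pi_succ, integral_prod _ (integrable_exp_of_forall_abs_le
      ((hfc.sub_const _).const_mul _) fun p => hbd _ _ (hC _) hmC)]
    calc ∫ z, ∫ S, Real.exp (t * (f (Fin.cons z S) - m)) ∂ν ∂μ
        = ∫ z, Real.exp (t * (g z - m)) *
            ∫ S, Real.exp (t * (f (Fin.cons z S) - g z)) ∂ν ∂μ := by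
          congr 1
          ext z
          rw [← integral_const_mul]
          congr 1
          ext S
          rw [← Real.exp_add]
          congr 1
          ring
      _ ≤ ∫ z, Real.exp (t * (g z - m)) * Real.exp (n * (c ^ 2 * t ^ 2 / 8)) ∂μ := by
          refine integral_mono_of_nonneg (.of_forall fun z => by positivity) ?_
            (.of_forall fun z => ?_)
          · exact (integrable_exp_of_forall_abs_le
              ((hgm.sub_const _).const_mul _) fun p => hbd _ _ (hgC _) hmC).mul_const _
          · exact mul_le_mul_of_nonneg_left (hinner z) (Real.exp_pos _).le
      _ ≤ Real.exp (c ^ 2 * t ^ 2 / 8) * Real.exp (n * (c ^ 2 * t ^ 2 / 8)) := by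
          rw [integral_mul_const]
          gcongr
          exact integral_exp_sub_integral_le μ hgm hgosc t
      _ = Real.exp ((n + 1 : ℕ) * (c ^ 2 * t ^ 2 / 8)) := by
          rw [← Real.exp_add]
          push_cast
          ring_nf

/-- **McDiarmid's inequality** for differences bounded by `1 / n`. -/
lemma measureReal_add_le_of_bounded_differences {n : ℕ} (hn : 0 < n) {f : (Fin n → Z) → ℝ}
    (hf : Measurable f) {C : ℝ} (hC : ∀ S, |f S| ≤ C)
    (hc : ∀ S i z, |f (Function.update S i z) - f S| ≤ 1 / n) {r : ℝ} (hr : 0 ≤ r) :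
    (Measure.pi fun _ => μ).real {S | ∫ S, f S ∂(Measure.pi fun _ => μ) + r ≤ f S} ≤
      Real.exp (-(2 * n * r ^ 2)) := by
  set ν : Measure (Fin n → Z) := Measure.pi fun _ => μ with hν
  set m := ∫ S, f S ∂ν with hm
  have hn' : (0 : ℝ) < n := by exact_mod_cast hn
  -- This t minimizes the Chernoff exponent -t r + t ^ 2 / (8 n).
  set t : ℝ := 4 * n * r with ht
  have hmC : |m| ≤ C := by
    have := norm_integral_le_of_norm_le_const (μ := ν) (f := f) (.of_forall fun S => hC _)
    simpa using this
  have h := integral_exp_le_of_bounded_differences μ hf hC hc t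
  have hint : Integrable (fun S => Real.exp (t * (f S - m))) ν :=
    integrable_exp_of_forall_abs_le ((hf.sub_const _).const_mul _) (C := |t| * (C + C)) fun S => by
      rw [abs_mul]
      gcongr
      exact (abs_sub _ _).trans (add_le_add (hC _) hmC)
  have hmark := ProbabilityTheory.measure_ge_le_exp_mul_mgf (μ := ν) (X := fun S => f S - m) r
    (t := t) (by positivity) hint
  have hset : {S | m + r ≤ f S} = {S | r ≤ f S - m} := by
    ext S
    simp only [Set.mem_ofPred_eq]
    constructor <;> intro h <;> linarith
  rw [hset]
  refine hmark.trans ?_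
  simp only [ProbabilityTheory.mgf]
  refine (mul_le_mul_of_nonneg_left h (Real.exp_pos _).le).trans ?_
  rw [← Real.exp_add]
  refine Real.exp_le_exp.2 (le_of_eq ?_)
  rw [ht]
  field_simp
  ring

end Concentration

/-! ### Rademacher averages -/

/-- The sign `±1` encoded by a Boolean. -/
def sgn (b : Bool) : ℝ := if b then 1 else -1

@[simp] lemma sgn_not (b : Bool) : sgn (!b) = -sgn b := by cases b <;> simp [sgn]

@[simp] lemma abs_sgn (b : Bool) : |sgn b| = 1 := by cases b <;> simp [sgn]

/-- The average over all sign patterns. -/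
noncomputable def radAvg {n : ℕ} (F : (Fin n → Bool) → ℝ) : ℝ := (∑ σ, F σ) / 2 ^ n

/-- The (unnormalized) Rademacher complexity of a family of vectors. -/
noncomputable def radSup {ι : Type*} {n : ℕ} (u : ι → Fin n → ℝ) : ℝ :=
  radAvg fun σ => ⨆ i, ∑ k, sgn (σ k) * u i k

lemma radAvg_mono {n : ℕ} {F G : (Fin n → Bool) → ℝ} (h : ∀ σ, F σ ≤ G σ) :
    radAvg F ≤ radAvg G := by
  unfold radAvg
  gcongr with σ
  exact h σ

lemma radAvg_add {n : ℕ} (F G : (Fin n → Bool) → ℝ) :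
    radAvg (fun σ => F σ + G σ) = radAvg F + radAvg G := by
  simp [radAvg, Finset.sum_add_distrib, add_div]

lemma radAvg_const {n : ℕ} (c : ℝ) : radAvg (fun _ : Fin n → Bool => c) = c := by
  simp [radAvg]

lemma radAvg_mul_left {n : ℕ} (c : ℝ) (F : (Fin n → Bool) → ℝ) :
    radAvg (fun σ => c * F σ) = c * radAvg F := by
  simp [radAvg, ← Finset.mul_sum, mul_div_assoc]

lemma radAvg_not {n : ℕ} (F : (Fin n → Bool) → ℝ) :
    radAvg (fun σ => F fun k => !σ k) = radAvg F := by
  unfold radAvg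
  congr 1
  refine Fintype.sum_equiv (Equiv.piCongrRight fun _ => Equiv.boolNot) _ _ fun σ => ?_
  rfl

section FiniteSup

variable {ι : Type*} [Finite ι]

lemma le_ciSup_of_finite (f : ι → ℝ) (i : ι) : f i ≤ ⨆ i, f i :=
  le_ciSup (Set.finite_range f).bddAbove i

variable [Nonempty ι]

lemma ciSup_add_le_add_ciSup (f g : ι → ℝ) : ⨆ i, (f i + g i) ≤ (⨆ i, f i) + ⨆ i, g i :=
  ciSup_le fun i => add_le_add (le_ciSup_of_finite f i) (le_ciSup_of_finite g i)

lemma abs_ciSup_sub_ciSup_le {f g : ι → ℝ} {c : ℝ} (h : ∀ i, |f i - g i| ≤ c) :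
    |(⨆ i, f i) - ⨆ i, g i| ≤ c := by
  have h1 : ⨆ i, f i ≤ (⨆ i, g i) + c := ciSup_le fun i => by
    linarith [(abs_le.1 (h i)).2, le_ciSup_of_finite g i]
  have h2 : ⨆ i, g i ≤ (⨆ i, f i) + c := ciSup_le fun i => by
    linarith [(abs_le.1 (h i)).1, le_ciSup_of_finite f i]
  rw [abs_le]
  constructor <;> linarith

lemma abs_ciSup_le {f : ι → ℝ} {c : ℝ} (h : ∀ i, |f i| ≤ c) : |⨆ i, f i| ≤ c := by
  have := abs_ciSup_sub_ciSup_le (f := f) (g := fun _ => 0) (c := c) (by simpa using h)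
  simpa using this

end FiniteSup

lemma abs_radAvg_sub_le {n : ℕ} {F G : (Fin n → Bool) → ℝ} {c : ℝ} (h : ∀ σ, |F σ - G σ| ≤ c) :
    |radAvg F - radAvg G| ≤ c := by
  have h1 : radAvg F ≤ radAvg G + c := by
    rw [← radAvg_const (n := n) c, ← radAvg_add]
    exact radAvg_mono fun σ => by linarith [(abs_le.1 (h σ)).2]
  have h2 : radAvg G ≤ radAvg F + c := by
    rw [← radAvg_const (n := n) c, ← radAvg_add]
    exact radAvg_mono fun σ => by linarith [(abs_le.1 (h σ)).1]
  rw [abs_le]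
  constructor <;> linarith

lemma abs_sum_sub_sum_update_le {Z : Type*} {n : ℕ} (ℓ : Z → ℝ) (h0 : ∀ z, 0 ≤ ℓ z)
    (h1 : ∀ z, ℓ z ≤ 1) (s : Fin n → ℝ) (hs : ∀ k, |s k| ≤ 1) (S : Fin n → Z) (i : Fin n) (z : Z) :
    |∑ k, s k * ℓ (Function.update S i z k) - ∑ k, s k * ℓ (S k)| ≤ 1 := by
  rw [← Finset.sum_sub_distrib, Finset.sum_eq_single i]
  · rw [← mul_sub, abs_mul, Function.update_self]
    have : |ℓ z - ℓ (S i)| ≤ 1 := by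
      rw [abs_le]
      constructor <;> linarith [h0 z, h1 z, h0 (S i), h1 (S i)]
    exact mul_le_one₀ (hs i) (abs_nonneg _) this
  · intro k _ hk
    simp [Function.update_of_ne hk]
  · simp

lemma abs_sum_mul_le {Z : Type*} {n : ℕ} (ℓ : Z → ℝ) (h0 : ∀ z, 0 ≤ ℓ z)
    (h1 : ∀ z, ℓ z ≤ 1) (s : Fin n → ℝ) (hs : ∀ k, |s k| ≤ 1) (S : Fin n → Z) :
    |∑ k, s k * ℓ (S k)| ≤ n := by
  refine (Finset.abs_sum_le_sum_abs _ _).trans ?_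
  calc ∑ k, |s k * ℓ (S k)| ≤ ∑ _k : Fin n, (1 : ℝ) := by
        refine Finset.sum_le_sum fun k _ => ?_
        rw [abs_mul, abs_of_nonneg (h0 _)]
        exact mul_le_one₀ (hs k) (h0 _) (h1 _)
    _ = n := by simp

/-! ### Symmetrization and uniform convergence -/

section Uniform

variable {Z : Type*} [MeasurableSpace Z] (μ : Measure Z) [IsProbabilityMeasure μ]
variable {ι : Type*} [Finite ι] {ℓ : ι → Z → ℝ}

lemma measurable_ciSup_sum (hm : ∀ i, Measurable (ℓ i)) {n : ℕ} (s : Fin n → ℝ) :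
    Measurable fun S : Fin n → Z => ⨆ i, ∑ k, s k * ℓ i (S k) := by
  refine Measurable.iSup fun i => ?_
  exact Finset.measurable_sum _ fun k _ => ((hm i).comp (measurable_pi_apply k)).const_mul _

lemma measurable_radSup (hm : ∀ i, Measurable (ℓ i)) {n : ℕ} :
    Measurable fun S : Fin n → Z => radSup fun i k => ℓ i (S k) := by
  unfold radSup radAvg
  exact (Finset.measurable_sum _ fun σ _ => measurable_ciSup_sum hm fun k => sgn (σ k)).div_const _

/-- The two members of each pair are exchangeable, independently over k; this is what allows random
signs to be inserted. -/
lemma integral_pi_prod_eq_integral_swap {n : ℕ} (σ : Fin n → Bool)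
    (H : (Fin n → Z × Z) → ℝ) (hH : Measurable H) :
    ∫ T, H T ∂(Measure.pi fun _ => μ.prod μ) =
      ∫ T, H (fun k => if σ k then T k else (T k).swap) ∂(Measure.pi fun _ => μ.prod μ) := by
  have hmp : MeasurePreserving (fun (T : Fin n → Z × Z) k => if σ k then T k else (T k).swap)
      (Measure.pi fun _ => μ.prod μ) (Measure.pi fun _ => μ.prod μ) := by
    refine measurePreserving_pi (f := fun k p => if σ k then p else p.swap)
      (fun _ => μ.prod μ) (fun _ => μ.prod μ) fun k => ?_
    cases σ k
    · simpa using Measure.measurePreserving_swap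
    · simpa [Function.id_def] using MeasurePreserving.id (μ.prod μ)
  rw [← hmp.map_eq, integral_map hmp.measurable.aemeasurable hH.aestronglyMeasurable, hmp.map_eq]

/-- For a fixed σ, swapping pairs according to σ turns the differences into signed ones, and the
supremum splits into one over the first sample with signs σ and one over the second with signs -σ.
Averaged over σ, the two parts are equal, hence the factor 2. -/
lemma integral_ciSup_sub_le [Nonempty ι] (hm : ∀ i, Measurable (ℓ i)) (h0 : ∀ i z, 0 ≤ ℓ i z)
    (h1 : ∀ i z, ℓ i z ≤ 1) {n : ℕ} :
    ∫ T, (⨆ i, ∑ k, (ℓ i (T k).1 - ℓ i (T k).2)) ∂(Measure.pi fun _ : Fin n => μ.prod μ) ≤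
      2 * ∫ S, radSup (fun i k => ℓ i (S k)) ∂(Measure.pi fun _ : Fin n => μ) := by
  set ν : Measure (Fin n → Z) := Measure.pi fun _ => μ with hν
  set ρ : Measure (Fin n → Z × Z) := Measure.pi fun _ => μ.prod μ with hρ
  set A : (Fin n → Bool) → (Fin n → Z) → ℝ := fun σ S => ⨆ i, ∑ k, sgn (σ k) * ℓ i (S k) with hA
  have hAm : ∀ σ, Measurable (A σ) := fun σ => measurable_ciSup_sum hm fun k => sgn (σ k)
  have hAb : ∀ σ S, |A σ S| ≤ n := fun σ S => abs_ciSup_le fun i =>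
    abs_sum_mul_le (ℓ i) (h0 i) (h1 i) _ (fun k => (abs_sgn _).le) S
  have hfst : MeasurePreserving (fun (T : Fin n → Z × Z) k => (T k).1) ρ ν :=
    measurePreserving_pi (fun _ => μ.prod μ) (fun _ => μ) fun _ => measurePreserving_fst
  have hsnd : MeasurePreserving (fun (T : Fin n → Z × Z) k => (T k).2) ρ ν :=
    measurePreserving_pi (fun _ => μ.prod μ) (fun _ => μ) fun _ => measurePreserving_snd
  have hHm : Measurable fun T : Fin n → Z × Z => ⨆ i, ∑ k, (ℓ i (T k).1 - ℓ i (T k).2) :=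
    Measurable.iSup fun i => Finset.measurable_sum _ fun k _ =>
      ((hm i).comp (measurable_fst.comp (measurable_pi_apply k))).sub
        ((hm i).comp (measurable_snd.comp (measurable_pi_apply k)))
  have hσ : ∀ σ : Fin n → Bool, ∫ T, (⨆ i, ∑ k, (ℓ i (T k).1 - ℓ i (T k).2)) ∂ρ ≤
      ∫ S, A σ S ∂ν + ∫ S, A (fun k => !σ k) S ∂ν := by
    intro σ
    have e1 : ∫ S, A σ S ∂ν = ∫ T, A σ (fun k => (T k).1) ∂ρ := by
      rw [← hfst.map_eq, integral_map hfst.measurable.aemeasurable (hAm σ).aestronglyMeasurable]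
    have e2 : ∫ S, A (fun k => !σ k) S ∂ν = ∫ T, A (fun k => !σ k) (fun k => (T k).2) ∂ρ := by
      rw [← hsnd.map_eq, integral_map hsnd.measurable.aemeasurable (hAm _).aestronglyMeasurable]
    have i1 : Integrable (fun T : Fin n → Z × Z => A σ fun k => (T k).1) ρ :=
      integrable_of_forall_abs_le ((hAm σ).comp hfst.measurable) fun T => hAb _ _
    have i2 : Integrable (fun T : Fin n → Z × Z => A (fun k => !σ k) fun k => (T k).2) ρ :=
      integrable_of_forall_abs_le ((hAm _).comp hsnd.measurable) fun T => hAb _ _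
    rw [e1, e2, ← integral_add i1 i2, hρ, integral_pi_prod_eq_integral_swap μ σ _ hHm]
    have hle : ∀ T : Fin n → Z × Z,
        (⨆ i, ∑ k, (ℓ i (if σ k then T k else (T k).swap).1 -
          ℓ i (if σ k then T k else (T k).swap).2)) ≤
        A σ (fun k => (T k).1) + A (fun k => !σ k) (fun k => (T k).2) := by
      intro T
      refine le_trans (le_of_eq ?_) (ciSup_add_le_add_ciSup _ _)
      congr 1
      ext i
      rw [← Finset.sum_add_distrib]
      refine Finset.sum_congr rfl fun k _ => ?_
      rw [sgn_not]
      cases σ k <;> simp [sgn] <;> ring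
    refine integral_mono ?_ (i1.add i2) hle
    refine integrable_of_forall_abs_le (C := n) ?_ fun T => ?_
    · refine hHm.comp (measurable_pi_lambda _ fun k => ?_)
      cases σ k
      · simpa [Function.comp_def] using measurable_swap.comp (measurable_pi_apply k)
      · simpa using measurable_pi_apply k
    · refine abs_ciSup_le fun i => (Finset.abs_sum_le_sum_abs _ _).trans ?_
      refine (Finset.sum_le_card_nsmul _ _ 1 fun k _ => ?_).trans (by simp)
      exact abs_sub_le_of_nonneg_of_le (h0 _ _) (h1 _ _) (h0 _ _) (h1 _ _)
  have hint : ∫ S, radSup (fun i k => ℓ i (S k)) ∂ν = radAvg fun σ => ∫ S, A σ S ∂ν := by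
    unfold radSup radAvg
    rw [integral_div, integral_finsetSum]
    exact fun σ _ => integrable_of_forall_abs_le (hAm σ) (hAb σ)
  rw [hint, two_mul]
  nth_rewrite 2 [← radAvg_not]
  rw [← radAvg_add]
  rw [← radAvg_const (n := n) (∫ T, (⨆ i, ∑ k, (ℓ i (T k).1 - ℓ i (T k).2)) ∂ρ)]
  exact radAvg_mono hσ

end Uniform

section Uniform

variable {Z : Type*} [MeasurableSpace Z] (μ : Measure Z) [IsProbabilityMeasure μ]

lemma integral_pi_sum {n : ℕ} {ℓ : Z → ℝ} (hm : Measurable ℓ) (h0 : ∀ z, 0 ≤ ℓ z)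
    (h1 : ∀ z, ℓ z ≤ 1) :
    ∫ S, ∑ k, ℓ (S k) ∂(Measure.pi fun _ : Fin n => μ) = n * ∫ z, ℓ z ∂μ := by
  have hk : ∀ k : Fin n, ∫ S, ℓ (S k) ∂(Measure.pi fun _ : Fin n => μ) = ∫ z, ℓ z ∂μ := by
    intro k
    have h := measurePreserving_eval (fun _ : Fin n => μ) k
    nth_rewrite 2 [← h.map_eq]
    rw [integral_map h.measurable.aemeasurable hm.aestronglyMeasurable]
  rw [integral_finsetSum]
  · simp [hk]
  · intro k _
    refine integrable_of_forall_abs_le (C := 1) (hm.comp (measurable_pi_apply k)) fun S => ?_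
    rw [abs_of_nonneg (h0 _)]
    exact h1 _

lemma abs_integral_sub_mean_le {n : ℕ} (hn : 0 < n) {ℓ : Z → ℝ} (hm : Measurable ℓ)
    (h0 : ∀ z, 0 ≤ ℓ z) (h1 : ∀ z, ℓ z ≤ 1) (S : Fin n → Z) :
    |∫ z, ℓ z ∂μ - (∑ k, ℓ (S k)) / n| ≤ 1 := by
  have hn' : (0 : ℝ) < n := by exact_mod_cast hn
  refine abs_sub_le_of_nonneg_of_le (integral_nonneg h0) ?_ ?_ ?_
  · have := integral_mono (integrable_of_forall_abs_le hm (C := 1) fun z => by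
      rw [abs_of_nonneg (h0 z)]; exact h1 z) (integrable_const (1 : ℝ)) h1 (μ := μ)
    simpa using this
  · exact div_nonneg (Finset.sum_nonneg fun k _ => h0 _) hn'.le
  · rw [div_le_one hn']
    exact (Finset.sum_le_card_nsmul _ _ 1 fun k _ => h1 _).trans (by simp)

section Finite

variable {ι : Type*} [Finite ι] [Nonempty ι] {ℓ : ι → Z → ℝ}

/-- **Symmetrization**. -/
lemma integral_ciSup_integral_sub_le (hm : ∀ i, Measurable (ℓ i)) (h0 : ∀ i z, 0 ≤ ℓ i z)
    (h1 : ∀ i z, ℓ i z ≤ 1) {n : ℕ} (hn : 0 < n) :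
    ∫ S, (⨆ i, (∫ z, ℓ i z ∂μ - (∑ k, ℓ i (S k)) / n)) ∂(Measure.pi fun _ : Fin n => μ) ≤
      2 * (∫ S, radSup (fun i k => ℓ i (S k)) ∂(Measure.pi fun _ : Fin n => μ)) / n := by
  set ν : Measure (Fin n → Z) := Measure.pi fun _ => μ with hν
  have hn' : (0 : ℝ) < n := by exact_mod_cast hn
  set G : (Fin n → Z) × (Fin n → Z) → ℝ := fun p => ⨆ i, ∑ k, (ℓ i (p.1 k) - ℓ i (p.2 k)) with hG
  have hGm : Measurable G :=
    Measurable.iSup fun i => Finset.measurable_sum _ fun k _ =>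
      ((hm i).comp ((measurable_pi_apply k).comp measurable_fst)).sub
        ((hm i).comp ((measurable_pi_apply k).comp measurable_snd))
  have hsb : ∀ i (S S' : Fin n → Z), |∑ k, (ℓ i (S k) - ℓ i (S' k))| ≤ n := by
    intro i S S'
    refine (Finset.abs_sum_le_sum_abs _ _).trans ?_
    refine (Finset.sum_le_card_nsmul _ _ 1 fun k _ => ?_).trans (by simp)
    exact abs_sub_le_of_nonneg_of_le (h0 _ _) (h1 _ _) (h0 _ _) (h1 _ _)
  have hGb : ∀ p, |G p| ≤ n := fun p => abs_ciSup_le fun i => hsb i _ _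
  have hGi : Integrable G (ν.prod ν) := integrable_of_forall_abs_le hGm hGb
  -- The population mean is an average over a ghost sample S', and a supremum of averages is at most
  -- the average of the suprema.
  have hpt : ∀ S, (⨆ i, (∫ z, ℓ i z ∂μ - (∑ k, ℓ i (S k)) / n)) ≤ (∫ S', G (S', S) ∂ν) / n := by
    intro S
    refine ciSup_le fun i => ?_
    rw [le_div_iff₀ hn', sub_mul, div_mul_cancel₀ _ hn'.ne', mul_comm,
      ← integral_pi_sum μ (hm i) (h0 i) (h1 i)]
    have hi1 : Integrable (fun S' : Fin n → Z => ∑ k, ℓ i (S' k)) ν := by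
      refine integrable_of_forall_abs_le (C := n)
        (Finset.measurable_sum _ fun k _ => (hm i).comp (measurable_pi_apply k)) fun S' => ?_
      have := abs_sum_mul_le (ℓ i) (h0 i) (h1 i) (fun _ => 1) (by simp) S'
      simpa using this
    calc ∫ S', ∑ k, ℓ i (S' k) ∂ν - ∑ k, ℓ i (S k)
        = ∫ S', (∑ k, ℓ i (S' k) - ∑ k, ℓ i (S k)) ∂ν := by
          rw [integral_sub hi1 (integrable_const _)]
          simp
      _ ≤ ∫ S', G (S', S) ∂ν := by
          refine integral_mono (hi1.sub (integrable_const _)) ?_ fun S' => ?_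
          · exact integrable_of_forall_abs_le (hGm.comp measurable_prodMk_right) fun S' => hGb _
          · simp only [← Finset.sum_sub_distrib, hG]
            exact le_ciSup_of_finite (fun i => ∑ k, (ℓ i (S' k) - ℓ i (S k))) i
  have hGint : ∫ p, G p ∂(ν.prod ν) =
      ∫ T, (⨆ i, ∑ k, (ℓ i (T k).1 - ℓ i (T k).2)) ∂(Measure.pi fun _ : Fin n => μ.prod μ) := by
    rw [← (measurePreserving_arrowProdEquivProdArrow Z Z (Fin n) (fun _ => μ)
      (fun _ => μ)).integral_comp' G]
    rfl
  have hsym := integral_ciSup_sub_le μ hm h0 h1 (n := n)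
  rw [← hGint, integral_prod_symm _ hGi] at hsym
  calc ∫ S, (⨆ i, (∫ z, ℓ i z ∂μ - (∑ k, ℓ i (S k)) / n)) ∂ν
      ≤ ∫ S, (∫ S', G (S', S) ∂ν) / n ∂ν := by
        refine integral_mono ?_ (hGi.integral_prod_right.div_const _) hpt
        refine integrable_of_forall_abs_le (C := 1) ?_ fun S => ?_
        · exact Measurable.iSup fun i => measurable_const.sub
            ((Finset.measurable_sum _ fun k _ => (hm i).comp (measurable_pi_apply k)).div_const _)
        · exact abs_ciSup_le fun i => abs_integral_sub_mean_le μ hn (hm i) (h0 i) (h1 i) S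
    _ = (∫ S, ∫ S', G (S', S) ∂ν ∂ν) / n := integral_div _ _
    _ ≤ _ := by gcongr

/-- McDiarmid's inequality is applied to the largest deviation Φ and to minus the normalized
complexity R, each with failure probability δ / 2. Outside both events Φ ≤ E Φ + r ≤ 2 E R + r ≤ 2 R
+ 3 r, which explains the factor 3. -/
lemma one_sub_le_measureReal_finite (hm : ∀ i, Measurable (ℓ i)) (h0 : ∀ i z, 0 ≤ ℓ i z)
    (h1 : ∀ i z, ℓ i z ≤ 1) {n : ℕ} (hn : 0 < n) {δ : ℝ} (hδ₀ : 0 < δ) (hδ₁ : δ < 1) :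
    1 - δ ≤ (Measure.pi fun _ : Fin n => μ).real {S | ∀ i, ∫ z, ℓ i z ∂μ ≤
      (∑ k, ℓ i (S k)) / n + 2 * radSup (fun i k => ℓ i (S k)) / n
        + 3 * √(Real.log (2 / δ) / (2 * n))} := by
  set ν : Measure (Fin n → Z) := Measure.pi fun _ => μ with hν
  have hn' : (0 : ℝ) < n := by exact_mod_cast hn
  set r := √(Real.log (2 / δ) / (2 * n)) with hr
  have hlog : 0 ≤ Real.log (2 / δ) := Real.log_nonneg (by rw [le_div_iff₀ hδ₀]; linarith)
  have hexp : Real.exp (-(2 * n * r ^ 2)) = δ / 2 := by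
    rw [hr, Real.sq_sqrt (by positivity), mul_div_cancel₀ _ (by positivity), ← Real.log_inv,
      Real.exp_log (by positivity), inv_div]
  set Φ : (Fin n → Z) → ℝ := fun S => ⨆ i, (∫ z, ℓ i z ∂μ - (∑ k, ℓ i (S k)) / n) with hΦ
  set R : (Fin n → Z) → ℝ := fun S => radSup (fun i k => ℓ i (S k)) / n with hR
  have hΦm : Measurable Φ := Measurable.iSup fun i => measurable_const.sub
    ((Finset.measurable_sum _ fun k _ => (hm i).comp (measurable_pi_apply k)).div_const _)
  have hRm : Measurable R := (measurable_radSup hm).div_const _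
  have hΦb : ∀ S, |Φ S| ≤ 1 := fun S =>
    abs_ciSup_le fun i => abs_integral_sub_mean_le μ hn (hm i) (h0 i) (h1 i) S
  have hRb : ∀ S, |R S| ≤ 1 := by
    intro S
    rw [hR, abs_div, abs_of_pos hn', div_le_one hn']
    have := abs_radAvg_sub_le (G := fun _ => 0) (c := n)
      (F := fun σ : Fin n → Bool => ⨆ i, ∑ k, sgn (σ k) * ℓ i (S k)) fun σ => by
        rw [sub_zero]
        exact abs_ciSup_le fun i => abs_sum_mul_le (ℓ i) (h0 i) (h1 i) _ (fun k => by simp) S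
    simpa [radSup, radAvg_const] using this
  have hΦd : ∀ S i z, |Φ (Function.update S i z) - Φ S| ≤ 1 / n := by
    intro S i z
    refine abs_ciSup_sub_ciSup_le fun j => ?_
    have := abs_sum_sub_sum_update_le (ℓ j) (h0 j) (h1 j) (fun _ => 1) (by simp) S i z
    simp only [one_mul] at this
    rw [sub_sub_sub_cancel_left, ← sub_div, abs_div, abs_of_pos hn', abs_sub_comm]
    gcongr
  have hRd : ∀ S i z, |-R (Function.update S i z) - -R S| ≤ 1 / n := by
    intro S i z
    rw [neg_sub_neg, abs_sub_comm, hR, ← sub_div, abs_div, abs_of_pos hn']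
    gcongr
    refine abs_radAvg_sub_le fun σ => abs_ciSup_sub_ciSup_le fun j => ?_
    exact abs_sum_sub_sum_update_le (ℓ j) (h0 j) (h1 j) _ (fun k => by simp) S i z
  have b1 := measureReal_add_le_of_bounded_differences μ hn hΦm hΦb hΦd (Real.sqrt_nonneg _ : 0 ≤ r)
  have b2 := measureReal_add_le_of_bounded_differences μ hn hRm.neg (C := 1)
    (fun S => by simpa using hRb S) hRd (Real.sqrt_nonneg _ : 0 ≤ r)
  rw [hexp] at b1 b2
  have hsym := integral_ciSup_integral_sub_le μ hm h0 h1 hn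
  have hsub : ({S | ∫ S, Φ S ∂ν + r ≤ Φ S} ∪ {S | ∫ S, (-R) S ∂ν + r ≤ (-R) S})ᶜ ⊆
      {S | ∀ i, ∫ z, ℓ i z ∂μ ≤
        (∑ k, ℓ i (S k)) / n + 2 * radSup (fun i k => ℓ i (S k)) / n + 3 * r} := by
    intro S hS i
    simp only [Set.compl_union, Set.mem_inter_iff, Set.mem_compl_iff, Set.mem_ofPred_eq, not_le,
      Pi.neg_apply, integral_neg] at hS
    have h3 := le_ciSup_of_finite (fun i => ∫ z, ℓ i z ∂μ - (∑ k, ℓ i (S k)) / n) i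
    have h4 : ∫ S, R S ∂ν = (∫ S, radSup (fun i k => ℓ i (S k)) ∂ν) / n := integral_div _ _
    rw [mul_div_assoc, ← h4] at hsym
    have h5 : 2 * radSup (fun i k => ℓ i (S k)) / n = 2 * R S := by rw [hR, mul_div_assoc]
    rw [h5]
    change ∫ z, ℓ i z ∂μ - (∑ k, ℓ i (S k)) / n ≤ Φ S at h3
    change ∫ S, Φ S ∂ν ≤ _ at hsym
    linarith [hS.1, hS.2]
  refine le_trans ?_ (measureReal_mono hsub)
  have hms : MeasurableSet ({S | ∫ S, Φ S ∂ν + r ≤ Φ S} ∪ {S | ∫ S, (-R) S ∂ν + r ≤ (-R) S}) :=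
    (measurableSet_le measurable_const hΦm).union (measurableSet_le measurable_const hRm.neg)
  rw [probReal_compl_eq_one_sub hms]
  have := measureReal_union_le (μ := ν) {S | ∫ S, Φ S ∂ν + r ≤ Φ S}
    {S | ∫ S, (-R) S ∂ν + r ≤ (-R) S}
  change ν.real {S | ∫ S, (-R) S ∂ν + r ≤ (-R) S} ≤ δ / 2 at b2
  linarith

end Finite

/-- Uniform convergence over a sequence of loss functions whose finite initial segments have
Rademacher complexity at most `b S` on the sample `S`. -/
lemma one_sub_le_measureReal_seq {ℓ : ℕ → Z → ℝ} (hm : ∀ i, Measurable (ℓ i))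
    (h0 : ∀ i z, 0 ≤ ℓ i z) (h1 : ∀ i z, ℓ i z ≤ 1) {n : ℕ} (hn : 0 < n) {δ : ℝ} (hδ₀ : 0 < δ)
    (hδ₁ : δ < 1) {b : (Fin n → Z) → ℝ} (hb : Measurable b)
    (hrad : ∀ m S, radSup (fun (i : Fin (m + 1)) k => ℓ i (S k)) ≤ b S) :
    MeasurableSet {S : Fin n → Z | ∀ i, ∫ z, ℓ i z ∂μ ≤ (∑ k, ℓ i (S k)) / n + 2 * b S / n
        + 3 * √(Real.log (2 / δ) / (2 * n))} ∧
      1 - δ ≤ (Measure.pi fun _ : Fin n => μ).real {S | ∀ i, ∫ z, ℓ i z ∂μ ≤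
        (∑ k, ℓ i (S k)) / n + 2 * b S / n + 3 * √(Real.log (2 / δ) / (2 * n))} := by
  set ν : Measure (Fin n → Z) := Measure.pi fun _ => μ with hν
  set r := √(Real.log (2 / δ) / (2 * n)) with hr
  have hn' : (0 : ℝ) < n := by exact_mod_cast hn
  set A : ℕ → Set (Fin n → Z) := fun m => {S | ∀ i ≤ m, ∫ z, ℓ i z ∂μ ≤
    (∑ k, ℓ i (S k)) / n + 2 * b S / n + 3 * r} with hA
  have hAm : ∀ m, MeasurableSet (A m) := by
    intro m
    simp only [hA, Set.ofPred_forall]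
    refine MeasurableSet.iInter fun i => MeasurableSet.iInter fun _ => ?_
    exact measurableSet_le measurable_const
      ((((Finset.measurable_sum _ fun k _ => (hm i).comp (measurable_pi_apply k)).div_const _).add
        ((hb.const_mul _).div_const _)).add_const _)
  have hAanti : Antitone A := fun m m' h S hS i hi => hS i (hi.trans h)
  have hAint : {S | ∀ i, ∫ z, ℓ i z ∂μ ≤ (∑ k, ℓ i (S k)) / n + 2 * b S / n + 3 * r} =
      ⋂ m, A m := by
    ext S
    simp only [hA, Set.mem_iInter, Set.mem_ofPred_eq]
    exact ⟨fun h m i _ => h i, fun h i => h i i le_rfl⟩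
  rw [hAint]
  refine ⟨MeasurableSet.iInter hAm, ?_⟩
  -- Continuity from above: the events for initial segments decrease, and each has probability at
  -- least 1 - δ with the same bound b.
  have hlim : Filter.Tendsto (fun m => ν.real (A m)) Filter.atTop (nhds (ν.real (⋂ m, A m))) := by
    have := tendsto_measure_iInter_atTop (μ := ν) (fun m => (hAm m).nullMeasurableSet) hAanti
      ⟨0, measure_ne_top _ _⟩
    exact (ENNReal.tendsto_toReal (measure_ne_top _ _)).comp this
  refine ge_of_tendsto' hlim fun m => ?_
  refine (one_sub_le_measureReal_finite μ (ℓ := fun i : Fin (m + 1) => ℓ i) (fun i => hm i)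
    (fun i => h0 i) (fun i => h1 i) hn hδ₀ hδ₁).trans (measureReal_mono ?_)
  intro S hS i hi
  refine (hS ⟨i, Nat.lt_succ_of_le hi⟩).trans ?_
  simp only
  have := hrad m S
  gcongr

end Uniform

/-! ### Contraction -/

section Contraction

variable {ι : Type*} [Finite ι] [Nonempty ι]

/-- Take maximizers i and j on the left. Then a i - a j ≤ |b i - b j|, and the sign of b i - b j
decides which of the two is tested in which supremum on the right. -/
lemma ciSup_add_ciSup_sub_le {g a b : ι → ℝ} (h : ∀ i j, |a i - a j| ≤ |b i - b j|) :
    (⨆ i, (g i + a i)) + (⨆ i, (g i - a i)) ≤ (⨆ i, (g i + b i)) + ⨆ i, (g i - b i) := by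
  obtain ⟨i, hi⟩ := exists_eq_ciSup_of_finite (f := fun i => g i + a i)
  obtain ⟨j, hj⟩ := exists_eq_ciSup_of_finite (f := fun i => g i - a i)
  rw [← hi, ← hj]
  have h1 := (le_abs_self _).trans (h i j)
  have h2 := le_ciSup_of_finite (fun i => g i + b i)
  have h3 := le_ciSup_of_finite (fun i => g i - b i)
  rcases abs_cases (b i - b j) with h4 | h4 <;> linarith [h2 i, h3 j, h2 j, h3 i]

lemma radAvg_flip {n : ℕ} (k : Fin n) (F : (Fin n → Bool) → ℝ) :
    radAvg (fun σ => F (Function.update σ k (!σ k))) = radAvg F := by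
  unfold radAvg
  congr 1
  have hinv : Function.Involutive fun σ : Fin n → Bool => Function.update σ k (!σ k) := by
    intro σ
    simp
  exact Fintype.sum_equiv hinv.toPerm _ _ fun σ => rfl

/-- Pairing each sign pattern with the one flipped at k reduces the claim to the inequality for two
suprema, with the other coordinates collected in g. -/
lemma radSup_le_radSup_of_agree_off {n : ℕ} {u v : ι → Fin n → ℝ} (k : Fin n)
    (hoff : ∀ i l, l ≠ k → v i l = u i l) (h : ∀ i j, |v i k - v j k| ≤ |u i k - u j k|) :
    radSup v ≤ radSup u := by
  have hdouble : ∀ w : ι → Fin n → ℝ, radSup w + radSup w = radAvg fun σ =>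
      (⨆ i, ∑ l, sgn (σ l) * w i l) +
        ⨆ i, ∑ l, sgn (Function.update σ k (!σ k) l) * w i l := by
    intro w
    rw [radAvg_add, radAvg_flip k fun σ => ⨆ i, ∑ l, sgn (σ l) * w i l]
    rfl
  suffices radSup v + radSup v ≤ radSup u + radSup u by linarith
  rw [hdouble, hdouble]
  refine radAvg_mono fun σ => ?_
  have e1 : ∀ (w : ι → Fin n → ℝ) i, ∑ l, sgn (σ l) * w i l =
      ∑ l ∈ Finset.univ.erase k, sgn (σ l) * w i l + sgn (σ k) * w i k := fun w i =>
    (Finset.sum_erase_add _ _ (Finset.mem_univ k)).symm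
  have e2 : ∀ (w : ι → Fin n → ℝ) i, ∑ l, sgn (Function.update σ k (!σ k) l) * w i l =
      ∑ l ∈ Finset.univ.erase k, sgn (σ l) * w i l - sgn (σ k) * w i k := by
    intro w i
    rw [← Finset.sum_erase_add _ _ (Finset.mem_univ k), Function.update_self, sgn_not, neg_mul,
      ← sub_eq_add_neg]
    congr 1
    refine Finset.sum_congr rfl fun l hl => ?_
    rw [Function.update_of_ne (Finset.ne_of_mem_erase hl)]
  have e3 : ∀ i, ∑ l ∈ Finset.univ.erase k, sgn (σ l) * v i l =
      ∑ l ∈ Finset.univ.erase k, sgn (σ l) * u i l := fun i =>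
    Finset.sum_congr rfl fun l hl => by rw [hoff i l (Finset.ne_of_mem_erase hl)]
  simp only [e1, e2, e3]
  refine ciSup_add_ciSup_sub_le fun i j => ?_
  rw [← mul_sub, ← mul_sub, abs_mul, abs_mul, abs_sgn, one_mul, one_mul]
  exact h i j

/-- **Talagrand's contraction principle**. -/
lemma radSup_le_radSup_of_contraction {n : ℕ} {u v : ι → Fin n → ℝ}
    (h : ∀ i j k, |v i k - v j k| ≤ |u i k - u j k|) : radSup v ≤ radSup u := by
  -- The coordinates of u are exchanged for those of v one at a time.
  have key : ∀ s : Finset (Fin n), radSup (fun i k => if k ∈ s then v i k else u i k) ≤ radSup u := by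
    intro s
    induction s using Finset.induction_on with
    | empty => simp
    | insert k s hk ih =>
      refine le_trans ?_ ih
      refine radSup_le_radSup_of_agree_off k (fun i l hl => ?_) fun i j => ?_
      · simp [hl]
      · simpa [hk] using h i j k
  simpa using key Finset.univ

lemma radSup_add_le {n : ℕ} (u w : ι → Fin n → ℝ) :
    radSup (fun i k => u i k + w i k) ≤ radSup u + radSup w := by
  unfold radSup
  rw [← radAvg_add]
  refine radAvg_mono fun σ => ?_
  simp only [mul_add, Finset.sum_add_distrib]
  exact ciSup_add_le_add_ciSup _ _

end Contraction

lemma radSup_const_mul {ι : Type*} {n : ℕ} {a : ℝ} (ha : 0 ≤ a) (u : ι → Fin n → ℝ) :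
    radSup (fun i k => a * u i k) = a * radSup u := by
  unfold radSup
  rw [← radAvg_mul_left]
  congr 1
  ext σ
  rw [Real.mul_iSup_of_nonneg ha]
  congr 1
  ext i
  rw [Finset.mul_sum]
  exact Finset.sum_congr rfl fun k _ => by ring

/-! ### Moments of Rademacher sums -/

lemma radAvg_sgn {n : ℕ} (k : Fin n) : radAvg (fun σ => sgn (σ k)) = 0 := by
  have h := radAvg_flip k fun σ => sgn (σ k)
  simp only [Function.update_self, sgn_not] at h
  have h2 := radAvg_mul_left (-1) fun σ : Fin n → Bool => sgn (σ k)
  simp only [neg_mul, one_mul] at h2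
  linarith

lemma radAvg_sgn_mul_sgn {n : ℕ} {k l : Fin n} (hkl : k ≠ l) :
    radAvg (fun σ => sgn (σ k) * sgn (σ l)) = 0 := by
  have h := radAvg_flip k fun σ => sgn (σ k) * sgn (σ l)
  simp only [Function.update_self, sgn_not, Function.update_of_ne hkl.symm] at h
  have h2 := radAvg_mul_left (-1) fun σ : Fin n → Bool => sgn (σ k) * sgn (σ l)
  simp only [neg_mul, one_mul] at h h2
  linarith

lemma radAvg_sum {n : ℕ} {κ : Type*} (s : Finset κ) (F : κ → (Fin n → Bool) → ℝ) :
    radAvg (fun σ => ∑ a ∈ s, F a σ) = ∑ a ∈ s, radAvg (F a) := by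
  unfold radAvg
  rw [Finset.sum_comm, Finset.sum_div]

lemma radAvg_sum_sgn {n : ℕ} : radAvg (fun σ : Fin n → Bool => ∑ k, sgn (σ k)) = 0 := by
  rw [radAvg_sum]
  exact Finset.sum_eq_zero fun k _ => radAvg_sgn k

lemma sgn_mul_self (b : Bool) : sgn b * sgn b = 1 := by cases b <;> simp [sgn]

lemma radAvg_sum_sgn_sq {n : ℕ} :
    radAvg (fun σ : Fin n → Bool => (∑ k, sgn (σ k)) ^ 2) = n := by
  simp only [sq, Finset.sum_mul_sum, radAvg_sum]
  calc ∑ k : Fin n, ∑ l, radAvg (fun σ => sgn (σ k) * sgn (σ l))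
      = ∑ k : Fin n, ∑ l : Fin n, if k = l then (1 : ℝ) else 0 := by
        refine Finset.sum_congr rfl fun k _ => Finset.sum_congr rfl fun l _ => ?_
        split_ifs with hkl
        · subst hkl
          simp only [sgn_mul_self, radAvg_const]
        · exact radAvg_sgn_mul_sgn hkl
    _ = n := by simp

/-- Average 2 √n |s| ≤ s ^ 2 + n over the signs; the second moment of s is n. -/
lemma radAvg_abs_sum_sgn_le {n : ℕ} (hn : 0 < n) :
    radAvg (fun σ : Fin n → Bool => |∑ k, sgn (σ k)|) ≤ √n := by
  have hs : 0 < √(n : ℝ) := Real.sqrt_pos.2 (by exact_mod_cast hn)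
  have hss : √(n : ℝ) * √n = n := Real.mul_self_sqrt (Nat.cast_nonneg n)
  have h : radAvg (fun σ : Fin n → Bool => 2 * √n * |∑ k, sgn (σ k)|) ≤
      radAvg fun σ : Fin n → Bool => (∑ k, sgn (σ k)) ^ 2 + n := by
    refine radAvg_mono fun σ => ?_
    nlinarith [sq_nonneg (|∑ k, sgn (σ k)| - √n), sq_abs (∑ k, sgn (σ k))]
  rw [radAvg_mul_left, radAvg_add, radAvg_sum_sgn_sq, radAvg_const] at h
  by_contra! hlt
  nlinarith

/-- With s the sum of the signs, -c s ≤ C (|s| - s) / 2 whenever 0 ≤ c ≤ C. The linear part averages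
to zero, so one-sidedness of the shift saves a factor 2. -/
lemma radSup_neg_const_le {ι : Type*} [Finite ι] [Nonempty ι] {n : ℕ} (hn : 0 < n) {c : ι → ℝ}
    {C : ℝ} (h0 : ∀ i, 0 ≤ c i) (hC : ∀ i, c i ≤ C) :
    radSup (fun i (_ : Fin n) => -c i) ≤ C * √n / 2 := by
  have hC0 : 0 ≤ C := (h0 (Classical.arbitrary ι)).trans (hC _)
  have h : radSup (fun i (_ : Fin n) => -c i) ≤
      radAvg fun σ : Fin n → Bool => C / 2 * (|∑ k, sgn (σ k)| + -1 * ∑ k, sgn (σ k)) := by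
    refine radAvg_mono fun σ => ciSup_le fun i => ?_
    rw [← Finset.sum_mul]
    set s := ∑ k, sgn (σ k)
    rcases abs_cases s with hs | hs
    · nlinarith [h0 i]
    · nlinarith [hC i]
  rw [radAvg_mul_left, radAvg_add, radAvg_mul_left, radAvg_sum_sgn] at h
  have := radAvg_abs_sum_sgn_le hn
  nlinarith

/-- By independence the average factors into cosh (t k), each at most exp (t k ^ 2 / 2). -/
lemma radAvg_exp_le {n : ℕ} (t : Fin n → ℝ) :
    radAvg (fun σ => Real.exp (∑ k, sgn (σ k) * t k)) ≤ Real.exp ((∑ k, t k ^ 2) / 2) := by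
  have h : radAvg (fun σ => Real.exp (∑ k, sgn (σ k) * t k)) = ∏ k, Real.cosh (t k) := by
    unfold radAvg
    simp only [Real.exp_sum]
    have : ∑ σ : Fin n → Bool, ∏ k, Real.exp (sgn (σ k) * t k) =
        ∏ k, ∑ b : Bool, Real.exp (sgn b * t k) := by
      rw [Finset.prod_univ_sum, Fintype.piFinset_univ]
    rw [this]
    simp only [Fintype.sum_bool, Real.cosh_eq, Finset.prod_div_distrib]
    simp [sgn]
  rw [h, Finset.sum_div, Real.exp_sum]
  exact Finset.prod_le_prod (fun k _ => (Real.cosh_pos _).le) fun k _ => Real.cosh_le_exp_half_sq _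

/-- Jensen's inequality, by way of the tangent bound 1 + y ≤ exp y at y = F - a. -/
lemma radAvg_le_of_radAvg_exp_le {n : ℕ} {F : (Fin n → Bool) → ℝ} {a : ℝ}
    (h : radAvg (fun σ => Real.exp (F σ)) ≤ Real.exp a) : radAvg F ≤ a := by
  have h1 : radAvg (fun σ => F σ + (1 - a)) ≤ radAvg fun σ => Real.exp (-a) * Real.exp (F σ) := by
    refine radAvg_mono fun σ => ?_
    rw [← Real.exp_add]
    linarith [Real.add_one_le_exp (-a + F σ)]
  rw [radAvg_add, radAvg_const, radAvg_mul_left] at h1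
  have h2 : Real.exp (-a) * radAvg (fun σ => Real.exp (F σ)) ≤ 1 := by
    calc _ ≤ Real.exp (-a) * Real.exp a := by gcongr
      _ = 1 := by rw [← Real.exp_add]; simp
  linarith

/-! ### Chaining -/

section Chaining

variable {ι : Type*} [Nonempty ι] {n : ℕ}

/-- Cauchy–Schwarz against a sign vector of norm √n; it handles the remainder below the finest
chaining scale. -/
lemma radSup_le_sqrt_mul {u : ι → EuclideanSpace ℝ (Fin n)} {r : ℝ} (hu : ∀ i, ‖u i‖ ≤ r) :
    radSup (fun i k => u i k) ≤ √n * r := by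
  rw [← radAvg_const (n := n) (√n * r)]
  refine radAvg_mono fun σ => ciSup_le fun i => ?_
  have h := Real.sum_mul_le_sqrt_mul_sqrt Finset.univ (fun k => sgn (σ k)) (fun k => u i k)
  have h1 : ∑ k : Fin n, sgn (σ k) ^ 2 = n := by simp [sq, sgn_mul_self]
  rw [h1, ← EuclideanSpace.real_norm_sq_eq, Real.sqrt_sq (norm_nonneg _)] at h
  exact h.trans (by gcongr; exact hu i)

variable [Finite ι]

/-- **Massart's finite class lemma**. -/
lemma radSup_le_of_card_le {I : Type*} [Fintype I] (c : I → EuclideanSpace ℝ (Fin n)) (p : ι → I)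
    {r a : ℝ} (hr : 0 < r) (ha : 0 < a) (hc : ∀ i, ‖c (p i)‖ ≤ r)
    (hcard : Real.log (Fintype.card I) ≤ a) :
    radSup (fun i k => c (p i) k) ≤ r * √(2 * a) := by
  classical
  have : Nonempty I := ⟨p (Classical.arbitrary ι)⟩
  -- This t balances the entropy a against the exponent t ^ 2 r ^ 2 / 2.
  set t := √(2 * a) / r with ht
  have hs : 0 < √(2 * a) := Real.sqrt_pos.2 (by linarith)
  have hss : √(2 * a) * √(2 * a) = 2 * a := Real.mul_self_sqrt (by linarith)
  have htp : 0 < t := by positivity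
  have htr : t ^ 2 * r ^ 2 = 2 * a := by
    rw [ht, div_pow, sq, hss]
    field_simp
  -- Centres outside the range of p may be long, so only the short ones enter the sum.
  set J : Finset I := Finset.univ.filter fun j => ‖c j‖ ≤ r with hJ
  have hexp : radAvg (fun σ => Real.exp (t * ⨆ i, ∑ k, sgn (σ k) * c (p i) k)) ≤
      Real.exp (2 * a) := by
    calc radAvg (fun σ => Real.exp (t * ⨆ i, ∑ k, sgn (σ k) * c (p i) k))
        ≤ radAvg fun σ => ∑ j ∈ J, Real.exp (∑ k, sgn (σ k) * (t * c j k)) := by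
          refine radAvg_mono fun σ => ?_
          obtain ⟨i, hi⟩ := exists_eq_ciSup_of_finite (f := fun i => ∑ k, sgn (σ k) * c (p i) k)
          rw [← hi, Finset.mul_sum]
          refine le_trans (le_of_eq ?_) (Finset.single_le_sum
            (f := fun j => Real.exp (∑ k, sgn (σ k) * (t * c j k)))
            (fun j _ => (Real.exp_pos _).le) (by simpa [hJ] using hc i : p i ∈ J))
          simp only
          congr 1
          exact Finset.sum_congr rfl fun k _ => by ring
      _ ≤ ∑ _j ∈ J, Real.exp a := by
          rw [radAvg_sum]
          refine Finset.sum_le_sum fun j hj => (radAvg_exp_le _).trans (Real.exp_le_exp.2 ?_)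
          have hj' : ‖c j‖ ≤ r := by simpa [hJ] using hj
          have : ∑ k, (t * c j k) ^ 2 = t ^ 2 * ‖c j‖ ^ 2 := by
            rw [EuclideanSpace.real_norm_sq_eq, Finset.mul_sum]
            exact Finset.sum_congr rfl fun k _ => by ring
          rw [this]
          have : t ^ 2 * ‖c j‖ ^ 2 ≤ t ^ 2 * r ^ 2 := by gcongr
          linarith
      _ ≤ Fintype.card I * Real.exp a := by
          rw [Finset.sum_const, nsmul_eq_mul]
          gcongr
          exact_mod_cast Finset.card_le_univ J
      _ ≤ Real.exp a * Real.exp a := by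
          gcongr
          rwa [← Real.log_le_iff_le_exp (by exact_mod_cast Fintype.card_pos)]
      _ = Real.exp (2 * a) := by rw [← Real.exp_add, two_mul]
  have h := radAvg_le_of_radAvg_exp_le hexp
  rw [radAvg_mul_left] at h
  change t * radSup (fun i k => c (p i) k) ≤ 2 * a at h
  rw [← hss, ht, div_mul_eq_mul_div, div_le_iff₀ hr, mul_assoc] at h
  have := le_of_mul_le_mul_left h hs
  linarith

/-- **Dudley's chaining bound** for coverings at the scales `B / 2 ^ j` with
`exp (2 * 4 ^ j * a)` elements. -/
lemma radSup_le_chaining {I : ℕ → Type*} [∀ j, Fintype (I j)]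
    {c : ∀ j, I j → EuclideanSpace ℝ (Fin n)} {p : ∀ j, ι → I j}
    {v : ι → EuclideanSpace ℝ (Fin n)} {B a : ℝ} (hB : 0 < B) (ha : 0 < a) (hv : ∀ i, ‖v i‖ ≤ B)
    (hc : ∀ j i, ‖v i - c j (p j i)‖ ≤ B / 2 ^ j)
    (hcard : ∀ j, Real.log (Fintype.card (I j)) ≤ 2 * 4 ^ j * a) (N : ℕ) :
    radSup (fun i k => v i k) ≤ B * ((4 + 27 / 4 * N) * √a + √n / 2 ^ N) := by
  have hcenter : radSup (fun i k => c N (p N i) k) ≤ B * ((4 + 27 / 4 * N) * √a) := by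
    induction N with
    | zero =>
      -- The coarsest centres have norm at most ‖v‖ + B ≤ 2 B, which yields the constant 4.
      have h := radSup_le_of_card_le (c 0) (p 0) (r := 2 * B) (a := 2 * a) (by positivity)
        (by positivity) (fun i => ?_) (by simpa using hcard 0)
      · have : √(2 * (2 * a)) = 2 * √a := by
          rw [← mul_assoc, Real.sqrt_mul (by norm_num), show (2 * 2 : ℝ) = 2 ^ 2 by norm_num,
            Real.sqrt_sq (by norm_num)]
        rw [this] at h
        refine h.trans (le_of_eq ?_)
        push_cast
        ring
      · have h1 := hc 0 i
        have h2 := norm_sub_norm_le (c 0 (p 0 i)) (v i)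
        rw [norm_sub_rev] at h2
        simp only [pow_zero, div_one] at h1
        linarith [hv i]
    | succ N ih =>
      have : ∀ j, Nonempty (I j) := fun j => ⟨p j (Classical.arbitrary ι)⟩
      -- A link has length at most B / 2 ^ N + B / 2 ^ (N + 1), and the pairs of centres have
      -- entropy (2 + 8) · 4 ^ N · a. With √20 ≤ 9 / 2 this costs 3 / 2 · 9 / 2 = 27 / 4 times B √a,
      -- whatever the level.
      have hstep := radSup_le_of_card_le (I := I N × I (N + 1))
        (fun q => c (N + 1) q.2 - c N q.1) (fun i => (p N i, p (N + 1) i))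
        (r := 3 / 2 * B / 2 ^ N) (a := 10 * 4 ^ N * a) (by positivity) (by positivity)
        (fun i => ?_) ?_
      · have hsqrt : √(2 * (10 * 4 ^ N * a)) ≤ 9 / 2 * 2 ^ N * √a := by
          refine Real.sqrt_le_iff.2 ⟨by positivity, ?_⟩
          rw [mul_pow, Real.sq_sqrt ha.le, mul_pow, ← pow_mul, mul_comm N 2, pow_mul]
          norm_num
          nlinarith [mul_pos (pow_pos (by norm_num : (0 : ℝ) < 4) N) ha]
        have hadd := radSup_add_le (fun i k => c N (p N i) k)
          (fun i k => (c (N + 1) (p (N + 1) i) - c N (p N i)) k)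
        have heq : (fun i k => c N (p N i) k + (c (N + 1) (p (N + 1) i) - c N (p N i)) k) =
            fun i k => c (N + 1) (p (N + 1) i) k := by
          ext i k
          simp
        rw [heq] at hadd
        have hmul : 3 / 2 * B / 2 ^ N * √(2 * (10 * 4 ^ N * a)) ≤ 27 / 4 * B * √a := by
          calc _ ≤ 3 / 2 * B / 2 ^ N * (9 / 2 * 2 ^ N * √a) := by gcongr
            _ = 27 / 4 * B * √a := by field_simp; ring
        have hstep' := hstep.trans hmul
        push_cast
        linarith
      · have h1 := hc N i
        have h2 := hc (N + 1) i
        have h3 := norm_sub_le_norm_sub_add_norm_sub (c (N + 1) (p (N + 1) i)) (v i) (c N (p N i))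
        rw [norm_sub_rev _ (v i)] at h3
        have h4 : B / 2 ^ (N + 1) + B / 2 ^ N = 3 / 2 * B / 2 ^ N := by
          rw [pow_succ]
          field_simp
          ring
        simp only
        linarith
      · rw [Fintype.card_prod, Nat.cast_mul, Real.log_mul (by exact_mod_cast Fintype.card_ne_zero)
          (by exact_mod_cast Fintype.card_ne_zero)]
        have h1 := hcard N
        have h2 := hcard (N + 1)
        rw [pow_succ] at h2
        linarith
  have hrest := radSup_le_sqrt_mul (u := fun i => v i - c N (p N i)) (hc N)
  have hadd := radSup_add_le (fun i k => c N (p N i) k) (fun i k => (v i - c N (p N i)) k)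
  have heq : (fun i k => c N (p N i) k + (v i - c N (p N i)) k) = fun i k => v i k := by
    ext i k
    simp
  rw [heq] at hadd
  have : √n * (B / 2 ^ N) = B * (√n / 2 ^ N) := by ring
  linarith

end Chaining

/-! ### Sparse approximation -/

section Sparse

variable {H : Type*} [NormedAddCommGroup H] [InnerProductSpace ℝ H]
variable {J : Type*}

/-- The vectors `± B U_j / ‖U_j‖` together with `0`. -/
noncomputable def atom (B : ℝ) (U : J → H) : Option (J × Bool) → H
  | none => 0
  | some (j, b) => (sgn b * (B / ‖U j‖)) • U j

/-- The average of `k` atoms. -/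
noncomputable def atomMean (B : ℝ) (U : J → H) (k : ℕ) (g : Fin k → Option (J × Bool)) : H :=
  (k : ℝ)⁻¹ • ∑ i, atom B U (g i)

lemma norm_atom_le {B : ℝ} (hB : 0 ≤ B) (U : J → H) (o : Option (J × Bool)) :
    ‖atom B U o‖ ≤ B := by
  rcases o with _ | ⟨j, b⟩
  · simpa [atom] using hB
  · rw [atom, norm_smul, Real.norm_eq_abs, abs_mul, abs_sgn, one_mul, abs_div, abs_norm,
      abs_of_nonneg hB]
    rcases (norm_nonneg (U j)).eq_or_lt with h | h
    · simpa [← h] using hB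
    · rw [div_mul_cancel₀ _ h.ne']

section Maurey

variable [Fintype J]

/-- For j drawn with law w, the vector y - V j has mean zero, so the cross term with r vanishes on
average and the variance is at most B ^ 2. Some j does no worse than the average. -/
lemma exists_norm_add_sub_sq_le (V : J → H) {w : J → ℝ} (hw0 : ∀ j, 0 ≤ w j) (hw1 : ∑ j, w j = 1)
    {B : ℝ} (hV : ∀ j, ‖V j‖ ≤ B) (r : H) :
    ∃ j, ‖r + (∑ j, w j • V j - V j)‖ ^ 2 ≤ ‖r‖ ^ 2 + B ^ 2 := by
  set y := ∑ j, w j • V j with hy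
  by_contra! hcon
  have h1 : ∑ j, w j * (‖r‖ ^ 2 + B ^ 2) < ∑ j, w j * ‖r + (y - V j)‖ ^ 2 := by
    obtain ⟨j, hj⟩ : ∃ j, 0 < w j := by
      by_contra! hneg
      have : ∑ j, w j ≤ 0 := Finset.sum_nonpos fun j _ => hneg j
      linarith
    exact Finset.sum_lt_sum (fun j _ => mul_le_mul_of_nonneg_left (hcon j).le (hw0 j))
      ⟨j, Finset.mem_univ j, mul_lt_mul_of_pos_left (hcon j) hj⟩
  have h2 : ∀ j, w j * ‖r + (y - V j)‖ ^ 2 =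
      w j * (‖r + y‖ ^ 2) - 2 * inner ℝ (r + y) (w j • V j) + w j * ‖V j‖ ^ 2 := by
    intro j
    rw [← add_sub_assoc, norm_sub_sq_real, inner_smul_right]
    ring
  have h3 : ∑ j, w j * ‖V j‖ ^ 2 ≤ B ^ 2 := by
    calc ∑ j, w j * ‖V j‖ ^ 2 ≤ ∑ j, w j * B ^ 2 := by
          gcongr with j _
          · exact hw0 j
          · exact hV j
      _ = B ^ 2 := by rw [← Finset.sum_mul, hw1, one_mul]
  simp only [h2] at h1
  rw [← Finset.sum_mul, hw1, one_mul, Finset.sum_add_distrib, Finset.sum_sub_distrib,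
    ← Finset.sum_mul, hw1, one_mul, ← Finset.mul_sum, ← inner_sum, ← hy] at h1
  have h4 : ‖r + y‖ ^ 2 - 2 * inner ℝ (r + y) y = ‖r‖ ^ 2 - ‖y‖ ^ 2 := by
    have := norm_sub_sq_real (r + y) y
    rw [add_sub_cancel_right] at this
    linarith
  nlinarith [sq_nonneg ‖y‖]

/-- The atoms are chosen greedily, each adding at most B ^ 2 to the squared error; this replaces
independent random sampling. -/
lemma exists_norm_smul_sub_sum_sq_le (V : J → H) {w : J → ℝ} (hw0 : ∀ j, 0 ≤ w j)
    (hw1 : ∑ j, w j = 1) {B : ℝ} (hV : ∀ j, ‖V j‖ ≤ B) (k : ℕ) :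
    ∃ g : Fin k → J, ‖(k : ℝ) • (∑ j, w j • V j) - ∑ i, V (g i)‖ ^ 2 ≤ k * B ^ 2 := by
  induction k with
  | zero => exact ⟨Fin.elim0, by simp⟩
  | succ k ih =>
    obtain ⟨g, hg⟩ := ih
    obtain ⟨j, hj⟩ := exists_norm_add_sub_sq_le V hw0 hw1 hV
      ((k : ℝ) • (∑ j, w j • V j) - ∑ i, V (g i))
    refine ⟨Fin.cons j g, ?_⟩
    have heq : ((k + 1 : ℕ) : ℝ) • (∑ j, w j • V j) -
        ∑ i, V ((Fin.cons j g : Fin (k + 1) → J) i) =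
        ((k : ℝ) • (∑ j, w j • V j) - ∑ i, V (g i)) + (∑ j, w j • V j - V j) := by
      rw [Fin.sum_univ_succ]
      simp only [Fin.cons_zero, Fin.cons_succ]
      push_cast
      rw [add_smul, one_smul]
      abel
    rw [heq]
    push_cast
    linarith

/-- **Maurey's sparsification lemma**. -/
lemma exists_norm_sub_atomMean_le {B : ℝ} (hB : 0 ≤ B) (U : J → H) {α : J → ℝ}
    (hα : ∑ j, |α j| * ‖U j‖ ≤ B) {k : ℕ} (hk : 0 < k) :
    ∃ g, ‖∑ j, α j • U j - atomMean B U k g‖ ≤ B / √k := by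
  have hk' : (0 : ℝ) < k := by exact_mod_cast hk
  rcases hB.eq_or_lt with rfl | hB'
  · refine ⟨fun _ => none, ?_⟩
    have h0 : ∀ j, α j • U j = 0 := by
      intro j
      have h1 : |α j| * ‖U j‖ ≤ 0 := (Finset.single_le_sum (f := fun j => |α j| * ‖U j‖)
        (fun j _ => by positivity) (Finset.mem_univ j)).trans hα
      rw [← norm_le_zero_iff, norm_smul]
      exact h1
    simp [h0, atomMean, atom]
  set β : J → ℝ := fun j => α j * ‖U j‖ / B with hβ
  have hβabs : ∀ j, |β j| = |α j| * ‖U j‖ / B := fun j => by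
    rw [hβ, abs_div, abs_mul, abs_norm, abs_of_pos hB']
  have hβsum : ∑ j, |β j| ≤ 1 := by
    simp only [hβabs]
    rw [← Finset.sum_div, div_le_one hB']
    exact hα
  -- The positive and negative parts of β j weight the two signed atoms, and the zero atom takes up
  -- the missing mass.
  set w : Option (J × Bool) → ℝ := fun o =>
    o.elim (1 - ∑ j, |β j|) fun q => (|β q.1| + sgn q.2 * β q.1) / 2 with hw
  have hw0 : ∀ o, 0 ≤ w o := by
    rintro (_ | ⟨j, b⟩)
    · simp only [hw, Option.elim_none]
      linarith
    · simp only [hw, Option.elim_some]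
      have := neg_abs_le (sgn b * β j)
      rw [abs_mul, abs_sgn, one_mul] at this
      linarith
  have hw1 : ∑ o, w o = 1 := by
    rw [Fintype.sum_option, Fintype.sum_prod_type]
    simp only [hw, Option.elim_none, Option.elim_some, Fintype.sum_bool]
    have : ∀ j, (|β j| + sgn true * β j) / 2 + (|β j| + sgn false * β j) / 2 = |β j| := by
      intro j
      simp only [sgn, if_true, Bool.false_eq_true, if_false]
      ring
    simp only [this]
    ring
  have hy : ∑ o, w o • atom B U o = ∑ j, α j • U j := by
    rw [Fintype.sum_option, Fintype.sum_prod_type]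
    simp only [hw, Option.elim_none, Option.elim_some, Fintype.sum_bool, atom, smul_zero, zero_add]
    refine Finset.sum_congr rfl fun j _ => ?_
    rw [smul_smul, smul_smul, ← add_smul]
    rcases eq_or_ne (U j) 0 with h | h
    · simp [h]
    · have hne : ‖U j‖ ≠ 0 := norm_ne_zero_iff.2 h
      congr 1
      simp only [sgn, if_true, Bool.false_eq_true, if_false, hβ]
      field_simp
      ring
  obtain ⟨g, hg⟩ := exists_norm_smul_sub_sum_sq_le (atom B U) hw0 hw1 (norm_atom_le hB U) k
  refine ⟨g, ?_⟩
  rw [hy] at hg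
  have heq : ∑ j, α j • U j - atomMean B U k g =
      (k : ℝ)⁻¹ • ((k : ℝ) • (∑ j, α j • U j) - ∑ i, atom B U (g i)) := by
    rw [smul_sub, smul_smul, inv_mul_cancel₀ hk'.ne', one_smul, atomMean]
  rw [heq, norm_smul, norm_inv, Real.norm_eq_abs, abs_of_pos hk', inv_mul_le_iff₀ hk']
  have hs : √(k : ℝ) * √k = k := Real.mul_self_sqrt hk'.le
  have hsp : 0 < √(k : ℝ) := Real.sqrt_pos.2 hk'
  have : (k : ℝ) * (B / √k) = √k * B := by
    rw [mul_div_assoc', div_eq_iff hsp.ne']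
    nlinarith
  rw [this]
  refine (abs_le_of_sq_le_sq' ?_ (by positivity)).2
  rw [mul_pow, Real.sq_sqrt hk'.le]
  exact hg

end Maurey

/-- The metric projection onto the closed ball of radius `r` around `0`. -/
noncomputable def ballProj (r : ℝ) (u : H) : H := if ‖u‖ ≤ r then u else (r / ‖u‖) • u

lemma norm_ballProj_le {r : ℝ} (hr : 0 ≤ r) (u : H) : ‖ballProj r u‖ ≤ r := by
  unfold ballProj
  split_ifs with h
  · exact h
  · have hu : 0 < ‖u‖ := hr.trans_lt (not_le.1 h)
    rw [norm_smul, Real.norm_eq_abs, abs_of_nonneg (by positivity), div_mul_cancel₀ _ hu.ne']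

/-- When u lies outside the ball, Cauchy–Schwarz shows that projecting lowers the squared distance
to v by at least (‖u‖ - r) ^ 2. -/
lemma norm_sub_ballProj_le {r : ℝ} (hr : 0 ≤ r) (u : H) {v : H} (hv : ‖v‖ ≤ r) :
    ‖v - ballProj r u‖ ≤ ‖v - u‖ := by
  unfold ballProj
  split_ifs with h
  · exact le_rfl
  · have hu : r < ‖u‖ := not_le.1 h
    have hu0 : 0 < ‖u‖ := hr.trans_lt hu
    set c := r / ‖u‖ with hc
    have hcu : c * ‖u‖ = r := div_mul_cancel₀ _ hu0.ne'
    have hc1 : c ≤ 1 := (div_le_one hu0).2 hu.le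
    refine (abs_le_of_sq_le_sq' ?_ (norm_nonneg _)).2
    rw [norm_sub_sq_real, norm_sub_sq_real, inner_smul_right, norm_smul, Real.norm_eq_abs,
      abs_of_nonneg (by positivity), hcu]
    have hin : inner ℝ v u ≤ r * ‖u‖ :=
      (real_inner_le_norm v u).trans (mul_le_mul_of_nonneg_right hv hu0.le)
    nlinarith [mul_le_mul_of_nonneg_left hin (sub_nonneg.2 hc1)]

end Sparse

/-! ### Coverings of the network class -/

section Cover

variable {n : ℕ}

/-- The matrix `W` applied to each of the `n` vectors `z (s, ·)`. -/
noncomputable def rowMap {m p : ℕ} (W : Matrix (Fin m) (Fin p) ℝ)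
    (z : EuclideanSpace ℝ (Fin n × Fin p)) : EuclideanSpace ℝ (Fin n × Fin m) :=
  WithLp.toLp 2 fun q => ∑ i, W q.2 i * z (q.1, i)

/-- The image of `z` under the matrix unit with index `(k, i)`. -/
noncomputable def unitImage {p : ℕ} (m : ℕ) (z : EuclideanSpace ℝ (Fin n × Fin p))
    (j : Fin m × Fin p) : EuclideanSpace ℝ (Fin n × Fin m) :=
  WithLp.toLp 2 fun q => if q.2 = j.1 then z (q.1, j.2) else 0

/-- The coordinatewise positive part. -/
noncomputable def reluMap {m : ℕ} (z : EuclideanSpace ℝ (Fin n × Fin m)) :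
    EuclideanSpace ℝ (Fin n × Fin m) :=
  WithLp.toLp 2 fun q => max (z q) 0

lemma rowMap_eq_sum {m p : ℕ} (W : Matrix (Fin m) (Fin p) ℝ)
    (z : EuclideanSpace ℝ (Fin n × Fin p)) :
    rowMap W z = ∑ j : Fin m × Fin p, W j.1 j.2 • unitImage m z j := by
  ext q
  simp [rowMap, unitImage, Fintype.sum_prod_type]

lemma rowMap_sub {m p : ℕ} (W : Matrix (Fin m) (Fin p) ℝ)
    (z z' : EuclideanSpace ℝ (Fin n × Fin p)) : rowMap W z - rowMap W z' = rowMap W (z - z') := by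
  ext q
  simp [rowMap, mul_sub]

lemma norm_unitImage {m p : ℕ} (z : EuclideanSpace ℝ (Fin n × Fin p)) (j : Fin m × Fin p) :
    ‖unitImage m z j‖ = √(∑ s, z (s, j.2) ^ 2) := by
  rw [EuclideanSpace.norm_eq]
  congr 1
  simp [unitImage, Fintype.sum_prod_type, ite_pow]

/-- Cauchy–Schwarz in each row: the norms of the unit images do not depend on the row and combine to
‖z‖. So the sum of the row norms of W controls the weight in Maurey's lemma. -/
lemma sum_abs_mul_norm_unitImage_le {m p : ℕ} (W : Matrix (Fin m) (Fin p) ℝ)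
    (z : EuclideanSpace ℝ (Fin n × Fin p)) :
    ∑ j : Fin m × Fin p, |W j.1 j.2| * ‖unitImage m z j‖ ≤ normTwoOne Wᵀ * ‖z‖ := by
  rw [Fintype.sum_prod_type, normTwoOne, Finset.sum_mul]
  refine Finset.sum_le_sum fun k _ => ?_
  simp only [norm_unitImage]
  refine (Real.sum_mul_le_sqrt_mul_sqrt _ _ _).trans (le_of_eq ?_)
  have h : ‖z‖ = √(∑ i, √(∑ s, z (s, i) ^ 2) ^ 2) := by
    rw [EuclideanSpace.norm_eq, Fintype.sum_prod_type, Finset.sum_comm]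
    congr 1
    refine Finset.sum_congr rfl fun i _ => ?_
    rw [Real.sq_sqrt (by positivity)]
    simp
  rw [h]
  simp

lemma norm_rowMap_le_normTwoOne {m p : ℕ} (W : Matrix (Fin m) (Fin p) ℝ)
    (z : EuclideanSpace ℝ (Fin n × Fin p)) : ‖rowMap W z‖ ≤ normTwoOne Wᵀ * ‖z‖ := by
  rw [rowMap_eq_sum]
  refine (norm_sum_le _ _).trans (le_trans (le_of_eq ?_) (sum_abs_mul_norm_unitImage_le W z))
  simp [norm_smul]

lemma norm_rowMap_le_spectralNorm {m p : ℕ} (W : Matrix (Fin m) (Fin p) ℝ)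
    (z : EuclideanSpace ℝ (Fin n × Fin p)) : ‖rowMap W z‖ ≤ spectralNorm W * ‖z‖ := by
  have h0 : 0 ≤ spectralNorm W := norm_nonneg _
  refine (abs_le_of_sq_le_sq' ?_ (by positivity)).2
  rw [mul_pow, EuclideanSpace.real_norm_sq_eq, EuclideanSpace.real_norm_sq_eq,
    Fintype.sum_prod_type, Fintype.sum_prod_type, Finset.mul_sum]
  refine Finset.sum_le_sum fun s _ => ?_
  have h := (Matrix.toEuclideanLin (𝕜 := ℝ) W).toContinuousLinearMap.le_opNorm
    (WithLp.toLp 2 fun i => z (s, i))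
  have h2 := pow_le_pow_left₀ (norm_nonneg _) h 2
  rw [mul_pow, EuclideanSpace.real_norm_sq_eq, EuclideanSpace.real_norm_sq_eq] at h2
  simpa [rowMap, Matrix.toLpLin_apply, Matrix.mulVec, dotProduct, spectralNorm] using h2

lemma norm_reluMap_sub_le {m : ℕ} (z z' : EuclideanSpace ℝ (Fin n × Fin m)) :
    ‖reluMap z - reluMap z'‖ ≤ ‖z - z'‖ := by
  refine (abs_le_of_sq_le_sq' ?_ (norm_nonneg _)).2
  rw [EuclideanSpace.real_norm_sq_eq, EuclideanSpace.real_norm_sq_eq]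
  refine Finset.sum_le_sum fun q _ => ?_
  simp only [reluMap, PiLp.sub_apply]
  exact sq_le_sq.2 (abs_max_sub_max_le_abs _ _ _)

lemma norm_reluMap_le {m : ℕ} (z : EuclideanSpace ℝ (Fin n × Fin m)) : ‖reluMap z‖ ≤ ‖z‖ := by
  have h0 : reluMap (0 : EuclideanSpace ℝ (Fin n × Fin m)) = 0 := by
    ext q
    simp [reluMap]
  simpa [h0] using norm_reluMap_sub_le z 0

lemma normTwoOne_transpose_le_entryNormOne {m p : ℕ} (W : Matrix (Fin m) (Fin p) ℝ) :
    normTwoOne Wᵀ ≤ entryNormOne W := by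
  refine Finset.sum_le_sum fun k _ => ?_
  refine Real.sqrt_le_iff.2 ⟨by positivity, ?_⟩
  calc ∑ i, Wᵀ i k ^ 2 = ∑ i, |W k i| ^ 2 := by simp
    _ ≤ (∑ i, |W k i|) ^ 2 := Finset.sum_sq_le_sq_sum_of_nonneg fun i _ => abs_nonneg _

/-- The element of the covering of the network class selected by two choices of `k` atoms. -/
noncomputable def coverCenter {d d₁ K : ℕ} (s₁ b₁ b₂ : ℝ) (X : EuclideanSpace ℝ (Fin n × Fin d))
    (k : ℕ) (g : (Fin k → Option ((Fin d₁ × Fin d) × Bool)) ×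
      (Fin k → Option ((Fin K × Fin d₁) × Bool))) : EuclideanSpace ℝ (Fin n × Fin K) :=
  atomMean (b₂ * (s₁ * ‖X‖)) (unitImage K
    (ballProj (s₁ * ‖X‖) (reluMap (atomMean (b₁ * ‖X‖) (unitImage d₁ X) k g.1)))) k g.2

/-- The first-layer error b₁ ‖X‖ / √k passes through ReLU unchanged and is multiplied by at most s₂
in the second layer. Sparsifying the second layer adds b₂ s₁ ‖X‖ / √k. -/
lemma exists_norm_sub_coverCenter_le {d d₁ K : ℕ} {s₁ s₂ b₁ b₂ : ℝ}
    {W₁ : Matrix (Fin d₁) (Fin d) ℝ} {W₂ : Matrix (Fin K) (Fin d₁) ℝ}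
    (h : InClass s₁ s₂ b₁ b₂ W₁ W₂) (X : EuclideanSpace ℝ (Fin n × Fin d)) {k : ℕ} (hk : 0 < k) :
    ∃ g, ‖rowMap W₂ (reluMap (rowMap W₁ X)) - coverCenter (d₁ := d₁) s₁ b₁ b₂ X k g‖ ≤
      (s₂ * b₁ + s₁ * b₂) * ‖X‖ / √k := by
  obtain ⟨hs₁, hs₂, hb₁, hb₂⟩ := h
  have hb₁' : normTwoOne W₁ᵀ ≤ b₁ := (normTwoOne_transpose_le_entryNormOne W₁).trans hb₁
  have hnn : ∀ {m p : ℕ} (W : Matrix (Fin m) (Fin p) ℝ), 0 ≤ normTwoOne W := fun W => by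
    unfold normTwoOne
    positivity
  have h1 : 0 ≤ b₁ := (hnn _).trans hb₁'
  have h2 : 0 ≤ b₂ := (hnn _).trans hb₂
  have h3 : 0 ≤ s₁ := (norm_nonneg _).trans hs₁
  have h4 : 0 ≤ s₂ := (norm_nonneg _).trans hs₂
  obtain ⟨g₁, hg₁⟩ := exists_norm_sub_atomMean_le (B := b₁ * ‖X‖) (by positivity)
    (unitImage d₁ X) (α := fun j => W₁ j.1 j.2)
    ((sum_abs_mul_norm_unitImage_le W₁ X).trans (by gcongr)) hk
  rw [← rowMap_eq_sum] at hg₁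
  -- The sparse first layer need not respect the spectral bound. Projecting restores the radius s₁
  -- ‖X‖ without increasing the distance to the true hidden layer.
  set z := ballProj (s₁ * ‖X‖) (reluMap (atomMean (b₁ * ‖X‖) (unitImage d₁ X) k g₁)) with hz
  have hzn : ‖z‖ ≤ s₁ * ‖X‖ := norm_ballProj_le (by positivity) _
  obtain ⟨g₂, hg₂⟩ := exists_norm_sub_atomMean_le (B := b₂ * (s₁ * ‖X‖)) (by positivity)
    (unitImage K z) (α := fun j => W₂ j.1 j.2)
    ((sum_abs_mul_norm_unitImage_le W₂ z).trans (by gcongr)) hk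
  rw [← rowMap_eq_sum] at hg₂
  refine ⟨(g₁, g₂), ?_⟩
  have hX : ‖reluMap (rowMap W₁ X)‖ ≤ s₁ * ‖X‖ :=
    (norm_reluMap_le _).trans ((norm_rowMap_le_spectralNorm W₁ X).trans (by gcongr))
  have hzdist : ‖reluMap (rowMap W₁ X) - z‖ ≤ b₁ * ‖X‖ / √k :=
    (norm_sub_ballProj_le (by positivity) _ hX).trans ((norm_reluMap_sub_le _ _).trans hg₁)
  have hd : ‖rowMap W₂ (reluMap (rowMap W₁ X)) - rowMap W₂ z‖ ≤ s₂ * (b₁ * ‖X‖ / √k) := by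
    rw [rowMap_sub]
    exact (norm_rowMap_le_spectralNorm _ _).trans (by gcongr)
  have htri := norm_sub_le_norm_sub_add_norm_sub (rowMap W₂ (reluMap (rowMap W₁ X)))
    (rowMap W₂ z) (coverCenter s₁ b₁ b₂ X k (g₁, g₂))
  refine htri.trans ((add_le_add hd hg₂).trans (le_of_eq ?_))
  ring

lemma norm_net_le {d d₁ K : ℕ} {s₁ s₂ b₁ b₂ : ℝ}
    {W₁ : Matrix (Fin d₁) (Fin d) ℝ} {W₂ : Matrix (Fin K) (Fin d₁) ℝ}
    (h : InClass s₁ s₂ b₁ b₂ W₁ W₂) (X : EuclideanSpace ℝ (Fin n × Fin d)) :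
    ‖rowMap W₂ (reluMap (rowMap W₁ X))‖ ≤ s₂ * b₁ * ‖X‖ := by
  obtain ⟨hs₁, hs₂, hb₁, hb₂⟩ := h
  have hb₁' : normTwoOne W₁ᵀ ≤ b₁ := (normTwoOne_transpose_le_entryNormOne W₁).trans hb₁
  have h4 : 0 ≤ s₂ := (norm_nonneg _).trans hs₂
  refine (norm_rowMap_le_spectralNorm _ _).trans ?_
  rw [mul_assoc]
  gcongr
  exact (norm_reluMap_le _).trans ((norm_rowMap_le_normTwoOne _ _).trans (by gcongr))

end Cover

/-! ### Rademacher complexity of the margins -/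

section Margin

variable {n K : ℕ}

lemma abs_maxOther_sub_le (hK : 2 ≤ K) {z z' : Fin K → ℝ} {y : Fin K} {r : ℝ}
    (h : ∀ k, k ≠ y → |z k - z' k| ≤ r) : |maxOther z y - maxOther z' y| ≤ r := by
  have h1 : maxOther z y ≤ maxOther z' y + r :=
    maxOther_le_add hK fun k hk => by linarith [(abs_le.1 (h k hk)).2]
  have h2 : maxOther z' y ≤ maxOther z y + r :=
    maxOther_le_add hK fun k hk => by linarith [(abs_le.1 (h k hk)).1]
  rw [abs_le]
  constructor <;> linarith

/-- The score of y and the maximum over its rivals depend on disjoint coordinates, and each changes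
by at most the Euclidean distance on its own; then (a - b) ^ 2 ≤ 2 (a ^ 2 + b ^ 2). -/
lemma margin_sub_sq_le (hK : 2 ≤ K) (z z' : Fin K → ℝ) (y : Fin K) :
    (margin z y - margin z' y) ^ 2 ≤ 2 * ∑ k, (z k - z' k) ^ 2 := by
  set r := √(∑ k ∈ Finset.univ.erase y, (z k - z' k) ^ 2) with hr
  have hr2 : r ^ 2 = ∑ k ∈ Finset.univ.erase y, (z k - z' k) ^ 2 := Real.sq_sqrt (by positivity)
  have h := abs_maxOther_sub_le hK (z := z) (z' := z') (y := y) (r := r) fun k hk =>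
    Real.abs_le_sqrt (Finset.single_le_sum (f := fun k => (z k - z' k) ^ 2)
      (fun _ _ => sq_nonneg _) (Finset.mem_erase.2 ⟨hk, Finset.mem_univ k⟩))
  rw [← Finset.sum_erase_add _ _ (Finset.mem_univ y), ← hr2]
  have h2 : (maxOther z y - maxOther z' y) ^ 2 ≤ r ^ 2 := sq_le_sq' (abs_le.1 h).1 (abs_le.1 h).2
  unfold margin
  nlinarith [sq_nonneg ((z y - z' y) + (maxOther z y - maxOther z' y))]

lemma margin_zero (y : Fin K) : margin (0 : Fin K → ℝ) y = 0 := by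
  simp [margin, maxOther]

/-- The vector of margins of `n` score vectors. -/
noncomputable def marginMap (y : Fin n → Fin K) (f : EuclideanSpace ℝ (Fin n × Fin K)) :
    EuclideanSpace ℝ (Fin n) :=
  WithLp.toLp 2 fun s => margin (fun k => f (s, k)) (y s)

lemma norm_marginMap_sub_le (hK : 2 ≤ K) (y : Fin n → Fin K)
    (f f' : EuclideanSpace ℝ (Fin n × Fin K)) :
    ‖marginMap y f - marginMap y f'‖ ≤ √2 * ‖f - f'‖ := by
  refine (abs_le_of_sq_le_sq' ?_ (by positivity)).2
  rw [mul_pow, Real.sq_sqrt (by norm_num), EuclideanSpace.real_norm_sq_eq,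
    EuclideanSpace.real_norm_sq_eq, Fintype.sum_prod_type, Finset.mul_sum]
  refine Finset.sum_le_sum fun s _ => ?_
  simpa [marginMap] using margin_sub_sq_le hK (fun k => f (s, k)) (fun k => f' (s, k)) (y s)

lemma norm_marginMap_le (hK : 2 ≤ K) (y : Fin n → Fin K)
    (f : EuclideanSpace ℝ (Fin n × Fin K)) : ‖marginMap y f‖ ≤ √2 * ‖f‖ := by
  have h0 : marginMap y (0 : EuclideanSpace ℝ (Fin n × Fin K)) = 0 := by
    ext s
    exact margin_zero (y s)
  simpa [h0] using norm_marginMap_sub_le hK y f 0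

/-- Each of the 2 k choices has at most 2 m ^ 2 + 1 ≤ (2 m) ^ 2 options, where m ≥ 1 because K ≥ 2.
The right side is arranged to fit the entropy hypothesis of the chaining bound with a = 2 log (2 m).
-/
lemma log_card_cover_le {d d₁ : ℕ} (hK : 2 ≤ K) (k : ℕ) :
    Real.log (Fintype.card ((Fin k → Option ((Fin d₁ × Fin d) × Bool)) ×
      (Fin k → Option ((Fin K × Fin d₁) × Bool)))) ≤
    2 * k * (2 * Real.log (2 * (max d (max d₁ K) : ℕ))) := by
  set m := max d (max d₁ K) with hm
  have h1 : d ≤ m := le_max_left _ _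
  have h2 : d₁ ≤ m := (le_max_left _ _).trans (le_max_right _ _)
  have h3 : K ≤ m := (le_max_right _ _).trans (le_max_right _ _)
  have hm1 : 1 ≤ m * m := Nat.mul_pos (by omega) (by omega)
  have hcard : Fintype.card ((Fin k → Option ((Fin d₁ × Fin d) × Bool)) ×
      (Fin k → Option ((Fin K × Fin d₁) × Bool))) ≤ (2 * m) ^ (4 * k) := by
    simp only [Fintype.card_prod, Fintype.card_pi, Fintype.card_option, Fintype.card_fin,
      Fintype.card_bool, Finset.prod_const, Finset.card_univ]
    have e1 : d₁ * d * 2 + 1 ≤ (2 * m) ^ 2 := by nlinarith [Nat.mul_le_mul h2 h1]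
    have e2 : K * d₁ * 2 + 1 ≤ (2 * m) ^ 2 := by nlinarith [Nat.mul_le_mul h3 h2]
    calc (d₁ * d * 2 + 1) ^ k * (K * d₁ * 2 + 1) ^ k
        ≤ ((2 * m) ^ 2) ^ k * ((2 * m) ^ 2) ^ k := by gcongr
      _ = (2 * m) ^ (4 * k) := by rw [← pow_mul, ← pow_add]; congr 1; ring
  calc Real.log (Fintype.card ((Fin k → Option ((Fin d₁ × Fin d) × Bool)) ×
        (Fin k → Option ((Fin K × Fin d₁) × Bool))))
      ≤ Real.log (((2 * m) ^ (4 * k) : ℕ) : ℝ) :=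
        Real.log_le_log (by exact_mod_cast Fintype.card_pos) (by exact_mod_cast hcard)
    _ = 2 * k * (2 * Real.log (2 * (m : ℕ))) := by
        push_cast
        rw [Real.log_pow]
        push_cast
        ring

/-- The level is the logarithm of n to base 4, rounded up. For n ≥ 4 rounding up at most doubles the
rounded-down value, and log 4 ≥ 4 / 3 turns the factor 2 into 3 / 2. -/
lemma exists_level (hn : 4 ≤ n) : ∃ N : ℕ, √(n : ℝ) / 2 ^ N ≤ 1 ∧ (N : ℝ) ≤ 3 / 2 * Real.log n := by
  refine ⟨Nat.clog 4 n, ?_, ?_⟩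
  · rw [div_le_one (by positivity)]
    refine Real.sqrt_le_iff.2 ⟨by positivity, ?_⟩
    have h := Nat.le_pow_clog (by norm_num : 1 < 4) n
    rw [← pow_mul, mul_comm, pow_mul]
    norm_num
    exact_mod_cast h
  · have hn0 : n ≠ 0 := by omega
    have h1 : Nat.clog 4 n ≤ Nat.log 4 n + 1 := Nat.clog_le_of_le_pow
      (Nat.lt_pow_succ_log_self (by norm_num) n).le
    have h2 : 1 ≤ Nat.log 4 n := Nat.log_pos (by norm_num) hn
    have h3 : (Nat.log 4 n : ℝ) * Real.log 4 ≤ Real.log n := by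
      rw [← Real.log_pow]
      refine Real.log_le_log (by positivity) ?_
      exact_mod_cast Nat.pow_log_le_self 4 hn0
    have h4 : (4 / 3 : ℝ) ≤ Real.log 4 := by
      rw [show (4 : ℝ) = 2 ^ 2 by norm_num, Real.log_pow]
      push_cast
      linarith [Real.log_two_gt_d9]
    have h5 : (Nat.clog 4 n : ℝ) ≤ 2 * Nat.log 4 n := by
      have : Nat.clog 4 n ≤ 2 * Nat.log 4 n := by omega
      exact_mod_cast this
    nlinarith [(Nat.cast_nonneg (Nat.log 4 n) : (0 : ℝ) ≤ Nat.log 4 n)]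

/-- Both logarithms are at least log 4 ≥ 4 / 3, which lets the additive constants and the square
root be absorbed into the product l a. -/
lemma chaining_constant_le {a l N q : ℝ} (ha : 4 / 3 ≤ a) (hl : 4 / 3 ≤ l)
    (hN : N ≤ 3 / 2 * l) (hq : q ≤ 1) :
    √2 * ((4 + 27 / 4 * N) * √(2 * a) + q) ≤ 30 * l * a := by
  have h1 : √(2 * a) ≤ 5 / 4 * a := Real.sqrt_le_iff.2 ⟨by positivity, by nlinarith⟩
  have h2 : √2 ≤ (3 / 2 : ℝ) := Real.sqrt_le_iff.2 ⟨by norm_num, by norm_num⟩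
  have hal : 16 / 9 ≤ l * a := by nlinarith
  have h3 : (4 + 27 / 4 * N) * √(2 * a) ≤ (3 * l + 81 / 8 * l) * (5 / 4 * a) := by
    gcongr ?_ * ?_
    linarith
  have h4 : (4 + 27 / 4 * N) * √(2 * a) + q ≤ 18 * (l * a) := by nlinarith
  have h5 : 0 ≤ √(2 : ℝ) := Real.sqrt_nonneg _
  have h6 : √2 ≤ (5 / 3 : ℝ) := by linarith
  calc √2 * ((4 + 27 / 4 * N) * √(2 * a) + q) ≤ √2 * (18 * (l * a)) := by gcongr
    _ ≤ 5 / 3 * (18 * (l * a)) := by gcongr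
    _ = 30 * l * a := by ring

/-- Rademacher complexity of the margins of the network class on a fixed sample. -/
lemma radSup_margin_le {ι : Type*} [Finite ι] [Nonempty ι] {d d₁ : ℕ} (hK : 2 ≤ K) (hn : 4 ≤ n)
    {s₁ s₂ b₁ b₂ : ℝ} (W₁ : ι → Matrix (Fin d₁) (Fin d) ℝ) (W₂ : ι → Matrix (Fin K) (Fin d₁) ℝ)
    (hW : ∀ i, InClass s₁ s₂ b₁ b₂ (W₁ i) (W₂ i)) (x : Fin n → Fin d → ℝ) (y : Fin n → Fin K) :
    radSup (fun i s => margin (net (W₁ i) (W₂ i) (x s)) (y s)) ≤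
      30 * Real.log n * Real.log (2 * (max d (max d₁ K) : ℕ)) *
        ((s₂ * b₁ + s₁ * b₂) * frobData x) := by
  set L := Real.log (2 * (max d (max d₁ K) : ℕ)) with hL
  have hlog4 : (4 / 3 : ℝ) ≤ Real.log 4 := by
    rw [show (4 : ℝ) = 2 ^ 2 by norm_num, Real.log_pow]
    push_cast
    linarith [Real.log_two_gt_d9]
  have hL1 : 4 / 3 ≤ L := by
    refine hlog4.trans (Real.log_le_log (by norm_num) ?_)
    have : 2 ≤ max d (max d₁ K) := hK.trans ((le_max_right _ _).trans (le_max_right _ _))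
    have : (2 : ℝ) ≤ (max d (max d₁ K) : ℕ) := by exact_mod_cast this
    linarith
  have hl1 : 4 / 3 ≤ Real.log n :=
    hlog4.trans (Real.log_le_log (by norm_num) (by exact_mod_cast hn))
  set X : EuclideanSpace ℝ (Fin n × Fin d) := WithLp.toLp 2 fun q => x q.1 q.2 with hX
  have hXn : ‖X‖ = frobData x := by
    rw [EuclideanSpace.norm_eq, Fintype.sum_prod_type]
    simp [frobData, hX]
  have hnet : (fun i s => margin (net (W₁ i) (W₂ i) (x s)) (y s)) =
      fun i s => marginMap y (rowMap (W₂ i) (reluMap (rowMap (W₁ i) X))) s := rfl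
  rw [hnet, ← hXn]
  have hs : ∀ i, 0 ≤ s₁ * b₂ := fun i => mul_nonneg ((norm_nonneg _).trans (hW i).1)
    (le_trans (by unfold normTwoOne; positivity) (hW i).2.2.2)
  -- Chaining needs a positive radius, while the natural one may vanish, for instance when X = 0. It
  -- is enlarged here and the excess sent to zero at the end.
  have hmain : ∀ B, 0 < B → (s₂ * b₁ + s₁ * b₂) * ‖X‖ ≤ B →
      radSup (fun i s => marginMap y (rowMap (W₂ i) (reluMap (rowMap (W₁ i) X))) s) ≤
        30 * Real.log n * L * B := by
    intro B hB hle
    obtain ⟨N, hN1, hN2⟩ := exists_level hn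
    choose p hp using fun (j : ℕ) i =>
      exists_norm_sub_coverCenter_le (hW i) X (pow_pos (by norm_num : 0 < 4) j)
    -- The factor √2 is the Lipschitz constant of the margin map.
    have h := radSup_le_chaining (a := 2 * L) (B := √2 * B)
      (c := fun j g => marginMap y (coverCenter s₁ b₁ b₂ X (4 ^ j) g)) (p := p)
      (v := fun i => marginMap y (rowMap (W₂ i) (reluMap (rowMap (W₁ i) X))))
      (by positivity) (by positivity) ?_ ?_ ?_ N
    · refine h.trans ?_
      have := chaining_constant_le hL1 hl1 hN2 hN1
      nlinarith
    · intro i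
      refine (norm_marginMap_le hK y _).trans ?_
      gcongr
      refine (norm_net_le (hW i) X).trans (le_trans ?_ hle)
      have := mul_nonneg (hs i) (norm_nonneg X)
      linarith
    · intro j i
      refine (norm_marginMap_sub_le hK y _ _).trans ?_
      rw [mul_div_assoc]
      gcongr
      refine (hp j i).trans ?_
      have h4 : √((4 ^ j : ℕ) : ℝ) = 2 ^ j := by
        push_cast
        rw [show (4 : ℝ) = 2 ^ 2 by norm_num, ← pow_mul, mul_comm, pow_mul,
          Real.sqrt_sq (by positivity)]
      rw [h4]
      gcongr
    · intro j
      have := log_card_cover_le (d := d) (d₁ := d₁) hK (4 ^ j)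
      rw [Nat.cast_pow, Nat.cast_ofNat] at this
      exact this
  have hc : 0 < 30 * Real.log n * L := by positivity
  refine le_of_forall_pos_le_add fun e he => ?_
  have hB0 : 0 ≤ (s₂ * b₁ + s₁ * b₂) * ‖X‖ :=
    (norm_nonneg _).trans ((hXn ▸ norm_net_le (hW (Classical.arbitrary ι)) X).trans (by
      have := mul_nonneg (hs (Classical.arbitrary ι)) (norm_nonneg X)
      rw [hXn] at this ⊢
      linarith))
  refine (hmain ((s₂ * b₁ + s₁ * b₂) * ‖X‖ + e / (30 * Real.log n * L)) (by positivity)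
    (by linarith [div_pos he hc])).trans (le_of_eq ?_)
  rw [mul_add, mul_div_cancel₀ _ hc.ne']

end Margin

/-! ### The ramp loss -/

/-- The ramp loss: `1` on `(-∞, 0]`, `0` on `[γ, ∞)` and linear in between. -/
noncomputable def ramp (γ m : ℝ) : ℝ := max 0 (min 1 (1 - m / γ))

lemma ramp_nonneg (γ m : ℝ) : 0 ≤ ramp γ m := le_max_left _ _

lemma ramp_le_one (γ m : ℝ) : ramp γ m ≤ 1 := max_le zero_le_one (min_le_left _ _)

lemma ramp_eq_one {γ m : ℝ} (hγ : 0 < γ) (hm : m ≤ 0) : ramp γ m = 1 := by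
  have : m / γ ≤ 0 := div_nonpos_of_nonpos_of_nonneg hm hγ.le
  rw [ramp, min_eq_left (by linarith), max_eq_right zero_le_one]

lemma ramp_eq_zero {γ m : ℝ} (hγ : 0 < γ) (hm : γ ≤ m) : ramp γ m = 0 := by
  have : 1 ≤ m / γ := (one_le_div hγ).2 hm
  rw [ramp, max_eq_left]
  exact (min_le_right _ _).trans (by linarith)

lemma abs_ramp_sub_le (γ m m' : ℝ) : |ramp γ m - ramp γ m'| ≤ |γ⁻¹ * m - γ⁻¹ * m'| := by
  unfold ramp
  have h1 := abs_max_sub_max_le_max 0 (min 1 (1 - m / γ)) 0 (min 1 (1 - m' / γ))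
  have h2 := abs_min_sub_min_le_max 1 (1 - m / γ) 1 (1 - m' / γ)
  refine h1.trans (max_le (by simp) (h2.trans (max_le (by simp) (le_of_eq ?_))))
  rw [sub_sub_sub_cancel_left, abs_sub_comm]
  congr 1
  ring

lemma continuous_ramp (γ : ℝ) : Continuous (ramp γ) := by
  unfold ramp
  fun_prop

lemma continuous_margin {K : ℕ} (hK : 2 ≤ K) (y : Fin K) :
    Continuous fun z : Fin K → ℝ => margin z y := by
  have h : LipschitzWith 1 fun z : Fin K → ℝ => maxOther z y :=
    LipschitzWith.of_dist_le_mul fun z z' => by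
      rw [Real.dist_eq, NNReal.coe_one, one_mul]
      exact abs_maxOther_sub_le hK fun k _ => dist_le_pi_dist z z' k
  exact (continuous_apply y).sub h.continuous

lemma continuous_net {d d₁ K : ℕ} :
    Continuous fun p : Matrix (Fin d₁) (Fin d) ℝ × Matrix (Fin K) (Fin d₁) ℝ × (Fin d → ℝ) =>
      net p.1 p.2.1 p.2.2 := by
  unfold net
  refine (continuous_fst.comp continuous_snd).matrix_mulVec (continuous_pi fun j => ?_)
  refine Continuous.max ?_ continuous_const
  exact (continuous_apply j).comp
    (continuous_fst.matrix_mulVec (continuous_snd.comp continuous_snd))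

/-- The loss of the network `(W₁, W₂)` when its margin is reduced by `e * c`. -/
noncomputable def rampLoss {d d₁ K : ℕ} (γ e : ℝ)
    (θ : Matrix (Fin d₁) (Fin d) ℝ × Matrix (Fin K) (Fin d₁) ℝ × ℝ)
    (q : (Fin d → ℝ) × Fin K) : ℝ :=
  ramp γ (margin (net θ.1 θ.2.1 q.1) q.2 - e * θ.2.2)

lemma continuous_rampLoss {d d₁ K : ℕ} (hK : 2 ≤ K) (γ e : ℝ) (q : (Fin d → ℝ) × Fin K) :
    Continuous fun θ : Matrix (Fin d₁) (Fin d) ℝ × Matrix (Fin K) (Fin d₁) ℝ × ℝ =>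
      rampLoss γ e θ q := by
  refine (continuous_ramp γ).comp (Continuous.sub ((continuous_margin hK q.2).comp ?_) (by fun_prop))
  exact continuous_net.comp (continuous_fst.prodMk
    ((continuous_fst.comp continuous_snd).prodMk continuous_const))

lemma measurable_margin_net {d d₁ K : ℕ} (hK : 2 ≤ K) (W₁ : Matrix (Fin d₁) (Fin d) ℝ)
    (W₂ : Matrix (Fin K) (Fin d₁) ℝ) :
    Measurable fun q : (Fin d → ℝ) × Fin K => margin (net W₁ W₂ q.1) q.2 := by
  refine measurable_from_prod_countable_left fun y => ?_
  refine Continuous.measurable ((continuous_margin hK y).comp ?_)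
  exact continuous_net.comp (continuous_const.prodMk (continuous_const.prodMk continuous_id))

lemma measurable_rampLoss {d d₁ K : ℕ} (hK : 2 ≤ K) (γ e : ℝ)
    (θ : Matrix (Fin d₁) (Fin d) ℝ × Matrix (Fin K) (Fin d₁) ℝ × ℝ) :
    Measurable (rampLoss γ e θ) :=
  (continuous_ramp γ).measurable.comp ((measurable_margin_net hK θ.1 θ.2.1).sub_const _)

/-- The robust error set is enclosed in a measurable margin set on which the ramp equals 1.
Monotonicity of the outer measure requires no measurability of the error set itself. -/
lemma measureReal_advError_le {d d₁ K : ℕ} (hK : 2 ≤ K)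
    (D : Measure ((Fin d → ℝ) × Fin K)) [IsProbabilityMeasure D] {γ : ℝ} (hγ : 0 < γ) (ε : ℝ)
    (W₁ : Matrix (Fin d₁) (Fin d) ℝ) (W₂ : Matrix (Fin K) (Fin d₁) ℝ) :
    D.real (advError (net W₁ W₂) ε) ≤
      ∫ q, rampLoss γ (ε / 2) (W₁, W₂, sdpTerm W₁ W₂) q ∂D := by
  set A : Set ((Fin d → ℝ) × Fin K) :=
    {p | margin (net W₁ W₂ p.1) p.2 - ε / 2 * sdpTerm W₁ W₂ ≤ 0} with hA
  have hAm : MeasurableSet A :=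
    measurableSet_le ((measurable_margin_net hK W₁ W₂).sub_const _) measurable_const
  refine (measureReal_mono (advError_subset hK W₁ W₂ ε)).trans ?_
  rw [← hA, ← integral_indicator_one hAm]
  refine integral_mono ((integrable_const (1 : ℝ)).indicator hAm)
    (integrable_of_forall_abs_le (measurable_rampLoss hK _ _ _) (C := 1) fun q => ?_) fun q => ?_
  · rw [rampLoss, abs_of_nonneg (ramp_nonneg _ _)]
    exact ramp_le_one _ _
  · by_cases hq : q ∈ A
    · rw [Set.indicator_of_mem hq, rampLoss, ramp_eq_one hγ hq]
      rfl
    · rw [Set.indicator_of_notMem hq]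
      exact ramp_nonneg _ _

lemma mean_rampLoss_le_surrogateError {d d₁ K n : ℕ} {γ : ℝ} (hγ : 0 < γ) (ε : ℝ)
    (W₁ : Matrix (Fin d₁) (Fin d) ℝ) (W₂ : Matrix (Fin K) (Fin d₁) ℝ)
    (S : Fin n → (Fin d → ℝ) × Fin K) :
    (∑ k, rampLoss γ (ε / 2) (W₁, W₂, sdpTerm W₁ W₂) (S k)) / n ≤ surrogateError ε γ W₁ W₂ S := by
  rw [surrogateError, one_div_mul_eq_div]
  gcongr with k
  rw [rampLoss]
  split_ifs with h
  · exact ramp_le_one _ _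
  · rw [ramp_eq_zero hγ]
    unfold margin
    linarith

/-! ### Complexity of the ramp losses and the form of the final bound -/

lemma radSup_rampLoss_le {ι : Type*} [Finite ι] [Nonempty ι] {d d₁ K n : ℕ} (hK : 2 ≤ K)
    (hn : 4 ≤ n) {ε s₁ s₂ b₁ b₂ γ : ℝ} (hε : 0 ≤ ε) (hγ : 0 < γ)
    (θ : ι → Matrix (Fin d₁) (Fin d) ℝ × Matrix (Fin K) (Fin d₁) ℝ × ℝ)
    (hW : ∀ i, InClass s₁ s₂ b₁ b₂ (θ i).1 (θ i).2.1) (h0 : ∀ i, 0 ≤ (θ i).2.2)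
    (h1 : ∀ i, (θ i).2.2 ≤ 4 * b₁ * b₂) (S : Fin n → (Fin d → ℝ) × Fin K) :
    radSup (fun i k => rampLoss γ (ε / 2) (θ i) (S k)) ≤
      γ⁻¹ * (30 * Real.log n * Real.log (2 * (max d (max d₁ K) : ℕ)) *
        ((s₂ * b₁ + s₁ * b₂) * frobData fun i => (S i).1) + ε * b₁ * b₂ * √n) := by
  set u : ι → Fin n → ℝ := fun i k => margin (net (θ i).1 (θ i).2.1 (S k).1) (S k).2 +
    -(ε / 2 * (θ i).2.2) with hu
  have hcontr : radSup (fun i k => rampLoss γ (ε / 2) (θ i) (S k)) ≤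
      radSup fun i k => γ⁻¹ * u i k :=
    radSup_le_radSup_of_contraction fun i j k => by
      simp only [rampLoss, sub_eq_add_neg _ (ε / 2 * _)]
      exact abs_ramp_sub_le _ _ _
  refine hcontr.trans ?_
  rw [radSup_const_mul (by positivity)]
  gcongr
  refine (radSup_add_le _ _).trans (add_le_add ?_ ?_)
  · exact radSup_margin_le hK hn (fun i => (θ i).1) (fun i => (θ i).2.1) hW
      (fun k => (S k).1) fun k => (S k).2
  -- For a fixed network the shift is the same at every sample point, so only the sum of the signs
  -- matters.
  · refine (radSup_neg_const_le (C := ε / 2 * (4 * b₁ * b₂)) (by omega)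
      (fun i => mul_nonneg (by positivity) (h0 i))
      fun i => mul_le_mul_of_nonneg_left (h1 i) (by positivity)).trans (le_of_eq ?_)
    ring

/-- Superadditivity of t ^ (3 / 2) on the nonnegative reals. The chaining bound is linear in the two
norm ratios, hence at least as strong as the stated 2/3-power form. -/
lemma add_le_rpow_two_thirds {a b : ℝ} (ha : 0 ≤ a) (hb : 0 ≤ b) :
    a + b ≤ (a ^ (2 / 3 : ℝ) + b ^ (2 / 3 : ℝ)) ^ (3 / 2 : ℝ) := by
  have h := Real.add_rpow_le_rpow_add (Real.rpow_nonneg ha (2 / 3)) (Real.rpow_nonneg hb (2 / 3))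
    (p := 3 / 2) (by norm_num)
  rw [← Real.rpow_mul ha, ← Real.rpow_mul hb] at h
  norm_num at h
  exact h

lemma complexity_le {n : ℕ} (hn : 4 ≤ n) {ε s₁ s₂ b₁ b₂ γ L F : ℝ} (hs₁ : 0 < s₁)
    (hs₂ : 0 < s₂) (hb₁ : 0 ≤ b₁) (hb₂ : 0 ≤ b₂) (hγ : 0 < γ) (hL : 0 ≤ L) (hF : 0 ≤ F) :
    2 * (γ⁻¹ * (30 * Real.log n * L * ((s₂ * b₁ + s₁ * b₂) * F) + ε * b₁ * b₂ * √n)) / n ≤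
      1 / γ * (4 / (n : ℝ) ^ (3 / 2 : ℝ) + 60 * Real.log n * L / n * s₁ * s₂
        * ((b₁ / s₁) ^ (2 / 3 : ℝ) + (b₂ / s₂) ^ (2 / 3 : ℝ)) ^ (3 / 2 : ℝ) * F
        + 2 * ε * b₁ * b₂ / √n) := by
  have hn' : (0 : ℝ) < n := by exact_mod_cast (by omega : 0 < n)
  have hlog : 0 ≤ Real.log n := Real.log_natCast_nonneg n
  have hsq : √(n : ℝ) / n = 1 / √n := Real.sqrt_div_self'
  set A := ((b₁ / s₁) ^ (2 / 3 : ℝ) + (b₂ / s₂) ^ (2 / 3 : ℝ)) ^ (3 / 2 : ℝ) with hA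
  have hA1 : b₁ / s₁ + b₂ / s₂ ≤ A := add_le_rpow_two_thirds (by positivity) (by positivity)
  have hA2 : s₂ * b₁ + s₁ * b₂ ≤ s₁ * s₂ * A := by
    calc s₂ * b₁ + s₁ * b₂ = s₁ * s₂ * (b₁ / s₁ + b₂ / s₂) := by field_simp
      _ ≤ _ := by gcongr
  calc 2 * (γ⁻¹ * (30 * Real.log n * L * ((s₂ * b₁ + s₁ * b₂) * F) + ε * b₁ * b₂ * √n)) / n
      = 1 / γ * (60 * Real.log n * L / n * (s₂ * b₁ + s₁ * b₂) * F
          + 2 * ε * b₁ * b₂ * (√n / n)) := by ring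
    _ ≤ 1 / γ * (60 * Real.log n * L / n * (s₁ * s₂ * A) * F
          + 2 * ε * b₁ * b₂ * (√n / n)) := by gcongr
    -- The term 4 / n ^ (3 / 2) is pure slack here.
    _ ≤ 1 / γ * (4 / (n : ℝ) ^ (3 / 2 : ℝ) + 60 * Real.log n * L / n * s₁ * s₂ * A * F
          + 2 * ε * b₁ * b₂ / √n) := by
        rw [hsq, mul_one_div]
        gcongr
        have : 0 ≤ 4 / (n : ℝ) ^ (3 / 2 : ℝ) := by positivity
        linarith

/-- Since log 2 / 6 ≥ 1 / 9, the confidence term alone makes the theorem trivial for very small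
samples. -/
lemma one_le_three_mul_sqrt {n : ℕ} (hn : 0 < n) (hn3 : n ≤ 3) {δ : ℝ} (hδ₀ : 0 < δ)
    (hδ₁ : δ < 1) : 1 ≤ 3 * √(Real.log (2 / δ) / (2 * n)) := by
  have hn' : (0 : ℝ) < n := by exact_mod_cast hn
  have hn3' : (n : ℝ) ≤ 3 := by exact_mod_cast hn3
  have h1 : Real.log 2 ≤ Real.log (2 / δ) :=
    Real.log_le_log (by norm_num) (by rw [le_div_iff₀ hδ₀]; linarith)
  have h2 : (1 / 3 : ℝ) ≤ √(Real.log (2 / δ) / (2 * n)) := by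
    refine Real.le_sqrt_of_sq_le ?_
    rw [le_div_iff₀ (by positivity)]
    linarith [Real.log_two_gt_d9]
  linarith

end AdvSDP

/-! ### Assembly: from a dense sequence of parameters to the whole class -/

theorem theorem8 {d d₁ K n : ℕ} (hK : 2 ≤ K) (hn : 0 < n)
    (D : Measure ((Fin d → ℝ) × Fin K)) [IsProbabilityMeasure D]
    (ε s₁ s₂ b₁ b₂ γ δ : ℝ) (hε : 0 ≤ ε) (hs₁ : 0 < s₁) (hs₂ : 0 < s₂)
    (hγ : 0 < γ) (hδ₀ : 0 < δ) (hδ₁ : δ < 1) :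
    ∃ E : Set (Fin n → (Fin d → ℝ) × Fin K), MeasurableSet E ∧
      1 - δ ≤ (Measure.pi fun _ : Fin n => D).real E ∧
      ∀ S ∈ E, ∀ (W₁ : Matrix (Fin d₁) (Fin d) ℝ) (W₂ : Matrix (Fin K) (Fin d₁) ℝ),
        AdvSDP.InClass s₁ s₂ b₁ b₂ W₁ W₂ →
        D.real (AdvSDP.advError (AdvSDP.net W₁ W₂) ε) ≤
          AdvSDP.surrogateError ε γ W₁ W₂ S
          + 1 / γ * (4 / (n : ℝ) ^ (3 / 2 : ℝ)
            + 60 * Real.log n * Real.log (2 * (max d (max d₁ K) : ℕ)) / n * s₁ * s₂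
              * ((b₁ / s₁) ^ (2 / 3 : ℝ) + (b₂ / s₂) ^ (2 / 3 : ℝ)) ^ (3 / 2 : ℝ)
              * AdvSDP.frobData (fun i => (S i).1)
            + 2 * ε * b₁ * b₂ / √n)
          + 3 * √(Real.log (2 / δ) / (2 * n)) := by
  have hL : 0 ≤ Real.log (2 * (max d (max d₁ K) : ℕ)) := by
    have : 2 ≤ max d (max d₁ K) := hK.trans ((le_max_right _ _).trans (le_max_right _ _))
    have : (2 : ℝ) ≤ (max d (max d₁ K) : ℕ) := by exact_mod_cast this
    exact Real.log_nonneg (by linarith)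
  have hb : ∀ {W₁ : Matrix (Fin d₁) (Fin d) ℝ} {W₂ : Matrix (Fin K) (Fin d₁) ℝ},
      AdvSDP.InClass s₁ s₂ b₁ b₂ W₁ W₂ → 0 ≤ b₁ ∧ 0 ≤ b₂ := fun h =>
    ⟨le_trans (by unfold AdvSDP.entryNormOne; positivity) h.2.2.1,
      le_trans (by unfold AdvSDP.normTwoOne; positivity) h.2.2.2⟩
  rcases Nat.lt_or_ge n 4 with hn4 | hn4
  · refine ⟨Set.univ, MeasurableSet.univ, by simp [hδ₀.le], fun S _ W₁ W₂ hW => ?_⟩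
    obtain ⟨hb₁, hb₂⟩ := hb hW
    have h1 := AdvSDP.one_le_three_mul_sqrt hn (by omega) hδ₀ hδ₁
    have h2 : D.real (AdvSDP.advError (AdvSDP.net W₁ W₂) ε) ≤ 1 := measureReal_le_one
    have h3 : 0 ≤ AdvSDP.surrogateError ε γ W₁ W₂ S := by
      unfold AdvSDP.surrogateError
      exact mul_nonneg (by positivity) (Finset.sum_nonneg fun i _ => by split_ifs <;> norm_num)
    have hF : 0 ≤ AdvSDP.frobData fun i => (S i).1 := Real.sqrt_nonneg _
    have hlog : 0 ≤ Real.log n := Real.log_natCast_nonneg n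
    refine h2.trans (h1.trans (le_add_of_nonneg_left (add_nonneg h3 ?_)))
    positivity
  -- The shift is a free third parameter instead of `sdpTerm W₁ W₂`. The loss is then visibly
  -- continuous in the parameters, and no continuity of the semidefinite value is needed.
  set Θ : Set (Matrix (Fin d₁) (Fin d) ℝ × Matrix (Fin K) (Fin d₁) ℝ × ℝ) :=
    {θ | AdvSDP.InClass s₁ s₂ b₁ b₂ θ.1 θ.2.1 ∧ 0 ≤ θ.2.2 ∧ θ.2.2 ≤ 4 * b₁ * b₂} with hΘ
  rcases isEmpty_or_nonempty Θ with hempty | hne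
  · refine ⟨Set.univ, MeasurableSet.univ, by simp [hδ₀.le], fun S _ W₁ W₂ hW => ?_⟩
    exact hempty.elim ⟨(W₁, W₂, AdvSDP.sdpTerm W₁ W₂), hW, AdvSDP.sdpTerm_nonneg _ _,
      AdvSDP.sdpTerm_le hW⟩
  have hsc : SecondCountableTopology
      (Matrix (Fin d₁) (Fin d) ℝ × Matrix (Fin K) (Fin d₁) ℝ × ℝ) :=
    inferInstanceAs (SecondCountableTopology
      ((Fin d₁ → Fin d → ℝ) × (Fin K → Fin d₁ → ℝ) × ℝ))
  set ℓ : ℕ → (Fin d → ℝ) × Fin K → ℝ := fun i =>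
    AdvSDP.rampLoss γ (ε / 2) (TopologicalSpace.denseSeq Θ i).1 with hℓ
  set b : (Fin n → (Fin d → ℝ) × Fin K) → ℝ := fun S =>
    γ⁻¹ * (30 * Real.log n * Real.log (2 * (max d (max d₁ K) : ℕ)) *
        ((s₂ * b₁ + s₁ * b₂) * AdvSDP.frobData fun i => (S i).1) + ε * b₁ * b₂ * √n) with hbdef
  have hbm : Measurable b := by
    have : Measurable fun S : Fin n → (Fin d → ℝ) × Fin K =>
        AdvSDP.frobData fun i => (S i).1 := by
      unfold AdvSDP.frobData
      fun_prop
    exact (((this.const_mul _).const_mul _).add_const _).const_mul _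
  obtain ⟨hEm, hE⟩ := AdvSDP.one_sub_le_measureReal_seq D (ℓ := ℓ)
    (fun i => AdvSDP.measurable_rampLoss hK _ _ _) (fun i z => AdvSDP.ramp_nonneg _ _)
    (fun i z => AdvSDP.ramp_le_one _ _) hn hδ₀ hδ₁ hbm
    (fun m S => AdvSDP.radSup_rampLoss_le hK hn4 hε hγ
      (fun i : Fin (m + 1) => (TopologicalSpace.denseSeq Θ i).1)
      (fun i => (TopologicalSpace.denseSeq Θ i).2.1)
      (fun i => (TopologicalSpace.denseSeq Θ i).2.2.1)
      (fun i => (TopologicalSpace.denseSeq Θ i).2.2.2) S)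
  refine ⟨_, hEm, hE, fun S hS W₁ W₂ hW => ?_⟩
  obtain ⟨hb₁, hb₂⟩ := hb hW
  -- For a fixed sample both sides are continuous in θ, the left one by dominated convergence. So
  -- the inequality passes from the dense sequence to all of Θ, in particular to the triple whose
  -- shift is `sdpTerm W₁ W₂`.
  have hclosed : IsClosed {θ : Θ | ∫ z, AdvSDP.rampLoss γ (ε / 2) θ.1 z ∂D ≤
      (∑ k, AdvSDP.rampLoss γ (ε / 2) θ.1 (S k)) / n + 2 * b S / n
        + 3 * √(Real.log (2 / δ) / (2 * n))} := by
    have hc : ∀ q, Continuous fun θ : Θ => AdvSDP.rampLoss γ (ε / 2) θ.1 q := fun q =>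
      (AdvSDP.continuous_rampLoss hK γ (ε / 2) q).comp continuous_subtype_val
    refine isClosed_le ?_ ?_
    · refine continuous_of_dominated (bound := fun _ => 1)
        (fun θ => (AdvSDP.measurable_rampLoss hK _ _ _).aestronglyMeasurable)
        (fun θ => .of_forall fun q => ?_) (integrable_const _) (.of_forall hc)
      rw [Real.norm_eq_abs, AdvSDP.rampLoss, abs_of_nonneg (AdvSDP.ramp_nonneg _ _)]
      exact AdvSDP.ramp_le_one _ _
    · exact (((continuous_finsetSum _ fun k _ => hc (S k)).div_const _).add_const _).add_const _
  have hall := (TopologicalSpace.denseRange_denseSeq Θ).closure_eq ▸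
    hclosed.closure_subset_iff.2 (Set.range_subset_iff.2 hS)
  have hθ := hall (Set.mem_univ (⟨(W₁, W₂, AdvSDP.sdpTerm W₁ W₂), hW,
    AdvSDP.sdpTerm_nonneg _ _, AdvSDP.sdpTerm_le hW⟩ : Θ))
  have h1 := AdvSDP.measureReal_advError_le hK D hγ ε W₁ W₂
  have h2 := AdvSDP.mean_rampLoss_le_surrogateError hγ ε W₁ W₂ S
  have h3 := AdvSDP.complexity_le hn4 (ε := ε) hs₁ hs₂ hb₁ hb₂ hγ hL
    (Real.sqrt_nonneg _ : 0 ≤ AdvSDP.frobData fun i => (S i).1)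
  exact h1.trans (hθ.trans (add_le_add (add_le_add h2 h3) le_rfl))
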